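/- An upward planar drawing of a finite simple digraph $G$ represents the vertices by distinct points of the plane and every edge $(u,v)$ by a curve from $u$ to $v$ along which the $y$-coordinate is strictly increasing, such that no edge passes through a vertex other than its ends and no two edges meet except at common end points. The problem UPDP is: given a digraph $G$ with an upward planar drawing, represented by adjacency lists in which the outgoing and the incoming edges of every vertex are listed from left to right as in the drawing, and given pairs of vertices $(s_1,t_1),\dots,(s_k,t_k)$, decide whether there are directed paths $P_1,\dots,P_k$ in $G$ such that $P_i$ links $s_i$ to $t_i$ for all $i$, and the paths are pairwise internally vertex disjoint, i.e. no $P_i$ contains an inner vertex of another $P_j$. Theorem. UPDP can be solved in time $\mathcal{O}(k!\cdot k\cdot n)$, where $n=|V(G)|$: there are a single program for a random access machine with unit costs (with addition, subtraction, comparison and indirect addressing as its arithmetic and memory operations) and a constant $C$, independent of $k$ and of $G$, such that on every instance with $k\ge 1$ the program halts after at most $C\cdot k!\cdot k\cdot n$ steps with the correct answer (for $k=0$, after at most $C$ steps). -/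

import Mathlib

open Set
open scoped Nat

/-! ### Upward planar drawings -/

/-- An upward planar drawing of a digraph: distinct vertices are distinct points of the plane, the
edge from `u` to `v` is a curve from the point of `u` to the point of `v` along which the
`y`-coordinate is strictly increasing, no edge passes through a vertex, and no two edges meet
except at common end points. -/
structure UpwardDrawing {V : Type} (G : Digraph V) where
  pos : V → ℝ × ℝ
  pos_injective : Function.Injective pos
  curve : ∀ {u v : V}, G.Adj u v → Path (pos u) (pos v)
  upward : ∀ {u v : V} (h : G.Adj u v), StrictMono fun t : unitInterval => (curve h t).2
  avoids_vertices : ∀ {u v : V} (h : G.Adj u v) (t : unitInterval), t ∈ Ioo (0 : unitInterval) 1 →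
    ∀ w : V, curve h t ≠ pos w
  noncrossing : ∀ {u v u' v' : V} (h : G.Adj u v) (h' : G.Adj u' v'), (u, v) ≠ (u', v') →
    ∀ s t : unitInterval, s ∈ Ioo (0 : unitInterval) 1 → t ∈ Ioo (0 : unitInterval) 1 →
      curve h s ≠ curve h' t

namespace UpwardDrawing

variable {V : Type} {G : Digraph V}

/-- The edge from `u` to `v` leaves `u` to the left of the edge from `u` to `w`: at all heights
slightly above `u`, the first edge has the smaller `x`-coordinate. -/
def OutLeft (D : UpwardDrawing G) (u v w : V) : Prop :=
  ∃ (h : G.Adj u v) (h' : G.Adj u w), ∃ y : ℝ, (D.pos u).2 < y ∧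
    ∀ s t : unitInterval, (D.curve h s).2 = (D.curve h' t).2 →
      (D.curve h s).2 ∈ Ioo (D.pos u).2 y → (D.curve h s).1 < (D.curve h' t).1

/-- The edge from `v` to `u` enters `u` to the left of the edge from `w` to `u`: at all heights
slightly below `u`, the first edge has the smaller `x`-coordinate. -/
def InLeft (D : UpwardDrawing G) (u v w : V) : Prop :=
  ∃ (h : G.Adj v u) (h' : G.Adj w u), ∃ y : ℝ, y < (D.pos u).2 ∧
    ∀ s t : unitInterval, (D.curve h s).2 = (D.curve h' t).2 →
      (D.curve h s).2 ∈ Ioo y (D.pos u).2 → (D.curve h s).1 < (D.curve h' t).1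

end UpwardDrawing

/-! ### Directed paths -/

/-- `p` is the vertex sequence of a directed path from `s` to `t`. -/
def IsDiPath {V : Type} (G : Digraph V) (s t : V) (p : List V) : Prop :=
  p.IsChain G.Adj ∧ p.Nodup ∧ p.head? = some s ∧ p.getLast? = some t

/-- `v` is an inner vertex of the path `p`, i.e. a vertex that is not one of its two ends. -/
def IsInner {V : Type} (p : List V) (v : V) : Prop :=
  v ∈ p ∧ p.head? ≠ some v ∧ p.getLast? ≠ some v

/-- Two paths are internally vertex disjoint if neither contains an inner vertex of the other. -/
def InternallyDisjoint {V : Type} (p q : List V) : Prop :=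
  (∀ v, IsInner p v → v ∉ q) ∧ (∀ v, IsInner q v → v ∉ p)

/-! ### Instances of the vertex disjoint paths problem on upward planar graphs -/

/-- An instance: a finite digraph on the vertices `0, …, n - 1` with an upward planar drawing, and
`k` pairs of vertices. The drawing is given combinatorially, by the lists of the out-neighbours and
of the in-neighbours of every vertex, ordered from left to right as in the drawing. -/
structure UPDPInstance where
  n : ℕ
  k : ℕ
  graph : Digraph (Fin n)
  drawing : UpwardDrawing graph
  outList : Fin n → List (Fin n)
  mem_outList : ∀ u v, v ∈ outList u ↔ graph.Adj u v
  outList_sorted : ∀ u, (outList u).Pairwise (drawing.OutLeft u)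
  inList : Fin n → List (Fin n)
  mem_inList : ∀ u v, v ∈ inList u ↔ graph.Adj v u
  inList_sorted : ∀ u, (inList u).Pairwise (drawing.InLeft u)
  source : Fin k → Fin n
  target : Fin k → Fin n

/-- There are pairwise internally vertex disjoint paths linking each source to its target. -/
def UPDPInstance.Solvable (J : UPDPInstance) : Prop :=
  ∃ p : Fin J.k → List (Fin J.n),
    (∀ i, IsDiPath J.graph (J.source i) (J.target i) (p i)) ∧
    ∀ i j, i ≠ j → InternallyDisjoint (p i) (p j)

/-! ### Random access machines with unit costs

The machine has registers and arrays of natural numbers. Its elementary operations are loading a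
constant, addition, (truncated) subtraction, reading and writing an array cell whose index is in a
register, and comparing two registers. Programs are structured. A program is a finite object, so it
uses only finitely many registers and finitely many arrays. -/

namespace RAM

/-- The content of all registers `reg r` and of all array cells `arr A i`. -/
structure State where
  reg : ℕ → ℕ
  arr : ℕ → ℕ → ℕ

/-- Comparisons of two registers. -/
inductive Test where
  | lt (a b : ℕ)
  | eq (a b : ℕ)

/-- Truth of a comparison. -/
def Test.Holds : Test → State → Prop
  | .lt a b, σ => σ.reg a < σ.reg b
  | .eq a b, σ => σ.reg a = σ.reg b

/-- Programs: `d`, `a`, `b`, `i` are register numbers, `A` is an array number, `c` a constant. -/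
inductive Prog where
  | skip
  | const (d c : ℕ)
  | add (d a b : ℕ)
  | sub (d a b : ℕ)
  | load (d A i : ℕ)
  | store (A i a : ℕ)
  | seq (p q : Prog)
  | ite (b : Test) (p q : Prog)
  | loop (b : Test) (p : Prog)

/-- Assign the value `x` to register `d`. -/
def State.setReg (σ : State) (d x : ℕ) : State :=
  { σ with reg := Function.update σ.reg d x }

/-- Assign the value `x` to cell `i` of array `A`. -/
def State.setArr (σ : State) (A i x : ℕ) : State :=
  { σ with arr := Function.update σ.arr A (Function.update (σ.arr A) i x) }

/-- `Runs p σ t τ`: started in state `σ`, the program `p` halts in state `τ` after exactly `t`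
steps. Every elementary operation and every evaluation of a comparison is one step. -/
inductive Runs : Prog → State → ℕ → State → Prop where
  | skip (σ : State) : Runs .skip σ 1 σ
  | const (σ : State) (d c : ℕ) : Runs (.const d c) σ 1 (σ.setReg d c)
  | add (σ : State) (d a b : ℕ) : Runs (.add d a b) σ 1 (σ.setReg d (σ.reg a + σ.reg b))
  | sub (σ : State) (d a b : ℕ) : Runs (.sub d a b) σ 1 (σ.setReg d (σ.reg a - σ.reg b))
  | load (σ : State) (d A i : ℕ) : Runs (.load d A i) σ 1 (σ.setReg d (σ.arr A (σ.reg i)))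
  | store (σ : State) (A i a : ℕ) : Runs (.store A i a) σ 1 (σ.setArr A (σ.reg i) (σ.reg a))
  | seq {p q : Prog} {σ τ υ : State} {t u : ℕ} :
      Runs p σ t τ → Runs q τ u υ → Runs (.seq p q) σ (t + u) υ
  | ite_true {b : Test} {p q : Prog} {σ τ : State} {t : ℕ} :
      b.Holds σ → Runs p σ t τ → Runs (.ite b p q) σ (t + 1) τ
  | ite_false {b : Test} {p q : Prog} {σ τ : State} {t : ℕ} :
      ¬ b.Holds σ → Runs q σ t τ → Runs (.ite b p q) σ (t + 1) τ
  | loop_false {b : Test} {p : Prog} {σ : State} :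
      ¬ b.Holds σ → Runs (.loop b p) σ 1 σ
  | loop_true {b : Test} {p : Prog} {σ τ υ : State} {t u : ℕ} :
      b.Holds σ → Runs p σ t τ → Runs (.loop b p) τ u υ → Runs (.loop b p) σ (t + u + 1) υ

end RAM

/-! ### Encoding of instances -/

/-- The concatenation of the lists `L 0, …, L (n - 1)`. -/
def concatLists {n : ℕ} (L : Fin n → List (Fin n)) : List ℕ :=
  (List.ofFn L).flatten.map Fin.val

/-- The position at which the list of vertex number `v` starts in the concatenation of all
lists; for `v = n` this is the total length. -/
def startIndex {n : ℕ} (L : Fin n → List (Fin n)) (v : ℕ) : ℕ :=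
  ∑ u : Fin n with u.val < v, (L u).length

/-- The initial state of the machine: `n` and `k` are in the registers `0` and `1`, the sources and
the targets of the `k` pairs are in the arrays `0` and `1`, the adjacency arrays of the graph (start
indices and concatenated neighbour lists, ordered from left to right) are in the arrays `2`, `3` for
the outgoing and `4`, `5` for the incoming edges, and everything else is `0`. -/
def UPDPInstance.initialState (J : UPDPInstance) : RAM.State where
  reg
    | 0 => J.n
    | 1 => J.k
    | _ => 0
  arr
    | 0 => fun i => if h : i < J.k then (J.source ⟨i, h⟩).val else 0
    | 1 => fun i => if h : i < J.k then (J.target ⟨i, h⟩).val else 0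
    | 2 => fun i => if i ≤ J.n then startIndex J.outList i else 0
    | 3 => fun i => (concatLists J.outList).getD i 0
    | 4 => fun i => if i ≤ J.n then startIndex J.inList i else 0
    | 5 => fun i => (concatLists J.inList).getD i 0
    | _ => fun _ => 0

/-! ### Edges and paths as functions of the height -/

/-! Since every edge rises strictly, edges and directed paths are graphs of continuous functions of
the height (`edgeX`, `pathX`), and the digraph is acyclic. By the intermediate value theorem, two
edges, and likewise two internally disjoint paths (`pathX_lt_pathX`), keep their horizontal order
throughout the open range of heights they share.

Order. For a family of disjoint paths, "strictly left of, at some common height" need not be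
transitive, but it can be bypassed at the path whose upper end is lowest: just below that end its
left and right neighbours are present too. Removing this path and reinserting it gives, by
induction, a numbering in which no path is right of a later one (`exists_pairwise_not_swap`,
`exists_orderedSolvable`).

Greedy choice. For a known left-to-right order, it suffices to link the pairs one by one, each by
the leftmost path that avoids all terminals and the inner vertices used before. Such a path lies
weakly left of every competing path (`IsOutList.pathX_le`), in particular of the corresponding path
of a hypothetical solution. If it met a later path of that solution in an inner vertex of both, the
path squeezed between them would pass through the same vertex, which disjointness forbids; so the
later paths survive (`OrderedSolvable.step`). Conversely, whatever the greedy procedure builds is a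
solution (`PartlySolved.step`). Trying all `k!` orders therefore decides the instance.

Time. The leftmost path is found by a depth first search that scans out-edges from left to right.
Abandoned vertices form a dead set, from which `t` cannot be reached (`IsDead`), so every edge left
of the stack path is useless. The search is linear in the number of edges, which is at most `5 * n`
(`IsOutList.sum_length_le`): an edge is charged to its tail if it is rightmost there, and otherwise
to a lowest vertex of the wedge between it and the next edge. Each order thus costs `O(k * n)`
steps. The orders are enumerated by counting in the factorial number system, whose digits encode a
permutation as a product of transpositions; a Hoare-style calculus with step bounds (`Within`)
transfers all this to the machine. -/

theorem lt_of_lt_of_forall_ne {f g : ℝ → ℝ} {a b y z : ℝ} (hf : Continuous f) (hg : Continuous g)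
    (hne : ∀ x ∈ Ioo a b, f x ≠ g x) (hy : y ∈ Icc a b) (hz : z ∈ Ioo a b) (h : f y < g y) :
    f z < g z := by
  by_contra! hle
  -- A reversal of the order would force a meeting point between `y` and `z`. It is not `y`, so it
  -- lies in the open interval even when `y` is an end point.
  obtain ⟨x, hx, hxe⟩ := isPreconnected_uIcc.intermediate_value₂ (left_mem_uIcc (a := y) (b := z))
    right_mem_uIcc hf.continuousOn hg.continuousOn h.le hle
  have hxy : x ≠ y := by rintro rfl; exact h.ne hxe
  refine hne x ?_ hxe
  rcases mem_uIcc.1 hx with hx | hx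
  · exact ⟨hy.1.trans_lt (lt_of_le_of_ne hx.1 hxy.symm), hx.2.trans_lt hz.2⟩
  · exact ⟨hz.1.trans_le hx.1, (lt_of_le_of_ne hx.2 hxy).trans_le hy.2⟩

namespace UpwardDrawing

variable {V : Type} {G : Digraph V} (D : UpwardDrawing G)

/-- The height of a vertex. -/
def ht (v : V) : ℝ := (D.pos v).2

/-- The horizontal coordinate of a vertex. -/
def hor (v : V) : ℝ := (D.pos v).1

variable {D} in
theorem eq_of_ht_hor {u v : V} (h : D.ht u = D.ht v) (h' : D.hor u = D.hor v) : u = v :=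
  D.pos_injective (Prod.ext h' h)

variable {D} in
theorem ht_lt {u v : V} (h : G.Adj u v) : D.ht u < D.ht v := by
  have := D.upward h (show (0 : unitInterval) < 1 from zero_lt_one)
  simpa [ht] using this

/-- The height is a strictly increasing continuous bijection from the parameter interval onto the
range of heights, hence an order isomorphism with continuous inverse; reparametrizing by it gives
`X`. The constant extension outside the range provides continuity on all of `ℝ`. -/
theorem exists_edge_function {u v : V} (h : G.Adj u v) :
    ∃ X : ℝ → ℝ, Continuous X ∧ (∀ y ≤ D.ht u, X y = D.hor u) ∧ X (D.ht v) = D.hor v ∧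
      ∀ y ∈ Icc (D.ht u) (D.ht v), ∃ t, D.curve h t = (X y, y) := by
  let f : unitInterval → ℝ := fun t => (D.curve h t).2
  have hf : StrictMono f := D.upward h
  have hc : Continuous f := continuous_snd.comp (D.curve h).continuous
  have hle : D.ht u ≤ D.ht v := (ht_lt h).le
  have h0 : f 0 = D.ht u := by simp [f, ht]
  have h1 : f 1 = D.ht v := by simp [f, ht]
  have hm : ∀ t, f t ∈ Icc (D.ht u) (D.ht v) := fun t =>
    ⟨h0 ▸ hf.monotone t.2.1, h1 ▸ hf.monotone t.2.2⟩
  let g : unitInterval → Icc (D.ht u) (D.ht v) := fun t => ⟨f t, hm t⟩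
  have hg : StrictMono g := fun a b hab => hf hab
  have hs : Function.Surjective g := by
    rintro ⟨y, hy⟩
    have := intermediate_value_univ (0 : unitInterval) 1 hc
    rw [h0, h1] at this
    obtain ⟨t, ht⟩ := this hy
    exact ⟨t, Subtype.ext ht⟩
  let e := StrictMono.orderIsoOfSurjective g hg hs
  have he : ∀ t, e t = g t := fun t => rfl
  have hes : ∀ y : Icc (D.ht u) (D.ht v), f (e.symm y) = y := fun y => by
    have : e (e.symm y) = y := e.apply_symm_apply y
    rw [he] at this
    exact congrArg Subtype.val this
  have h0' : e.symm ⟨D.ht u, left_mem_Icc.2 hle⟩ = 0 := by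
    rw [OrderIso.symm_apply_eq, he]; exact Subtype.ext h0.symm
  have h1' : e.symm ⟨D.ht v, right_mem_Icc.2 hle⟩ = 1 := by
    rw [OrderIso.symm_apply_eq, he]; exact Subtype.ext h1.symm
  refine ⟨IccExtend hle fun y => (D.curve h (e.symm y)).1, ?_, fun y hy => ?_, ?_, fun y hy => ?_⟩
  · apply Continuous.Icc_extend'
    exact continuous_fst.comp ((D.curve h).continuous.comp e.symm.continuous)
  · rw [IccExtend_of_le_left _ _ hy, h0']; simp [hor]
  · rw [IccExtend_right, h1']; simp [hor]
  · refine ⟨e.symm ⟨y, hy⟩, Prod.ext ?_ (hes ⟨y, hy⟩)⟩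
    rw [IccExtend_of_mem _ _ hy]

open Classical in
/-- The horizontal coordinate of the edge from `u` to `v` at a given height. -/
noncomputable def edgeX (u v : V) : ℝ → ℝ :=
  if h : G.Adj u v then (D.exists_edge_function h).choose else 0

theorem continuous_edgeX (u v : V) : Continuous (D.edgeX u v) := by
  unfold edgeX
  split_ifs with h
  · exact (D.exists_edge_function h).choose_spec.1
  · exact continuous_const

variable {D}

theorem edgeX_of_le {u v : V} (h : G.Adj u v) {y : ℝ} (hy : y ≤ D.ht u) :
    D.edgeX u v y = D.hor u := by
  rw [edgeX, dif_pos h]; exact (D.exists_edge_function h).choose_spec.2.1 y hy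

theorem edgeX_top {u v : V} (h : G.Adj u v) : D.edgeX u v (D.ht v) = D.hor v := by
  rw [edgeX, dif_pos h]; exact (D.exists_edge_function h).choose_spec.2.2.1

theorem exists_curve_eq {u v : V} (h : G.Adj u v) {y : ℝ} (hy : y ∈ Icc (D.ht u) (D.ht v)) :
    ∃ t, D.curve h t = (D.edgeX u v y, y) := by
  rw [edgeX, dif_pos h]; exact (D.exists_edge_function h).choose_spec.2.2.2 y hy

theorem exists_curve_eq_Ioo {u v : V} (h : G.Adj u v) {y : ℝ} (hy : y ∈ Ioo (D.ht u) (D.ht v)) :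
    ∃ t ∈ Ioo (0 : unitInterval) 1, D.curve h t = (D.edgeX u v y, y) := by
  obtain ⟨t, ht⟩ := exists_curve_eq h (Ioo_subset_Icc_self hy)
  refine ⟨t, ⟨?_, ?_⟩, ht⟩
  · refine lt_of_le_of_ne t.2.1 fun h0 => hy.1.ne ?_
    rw [← h0] at ht
    simpa [UpwardDrawing.ht] using congrArg Prod.snd ht
  · refine lt_of_le_of_ne t.2.2 fun h0 => hy.2.ne ?_
    rw [h0] at ht
    simpa [UpwardDrawing.ht] using (congrArg Prod.snd ht).symm

theorem edgeX_ne_edgeX {u v u' v' : V} (h : G.Adj u v) (h' : G.Adj u' v')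
    (hne : (u, v) ≠ (u', v')) {y : ℝ} (hy : y ∈ Ioo (D.ht u) (D.ht v))
    (hy' : y ∈ Ioo (D.ht u') (D.ht v')) : D.edgeX u v y ≠ D.edgeX u' v' y := by
  obtain ⟨s, hs, hse⟩ := exists_curve_eq_Ioo h hy
  obtain ⟨t, ht, hte⟩ := exists_curve_eq_Ioo h' hy'
  intro he
  exact D.noncrossing h h' hne s t hs ht (by rw [hse, hte, he])

theorem edgeX_ne_hor {u v w : V} (h : G.Adj u v) (hw : D.ht w ∈ Ioo (D.ht u) (D.ht v)) :
    D.edgeX u v (D.ht w) ≠ D.hor w := by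
  obtain ⟨s, hs, hse⟩ := exists_curve_eq_Ioo h hw
  intro he
  exact D.avoids_vertices h s hs w (by rw [hse, he]; rfl)

/-- Edges keep their horizontal order. -/
theorem edgeX_lt_edgeX {u v u' v' : V} (h : G.Adj u v) (h' : G.Adj u' v') {a b y z : ℝ}
    (ha : D.ht u ≤ a) (ha' : D.ht u' ≤ a) (hb : b ≤ D.ht v) (hb' : b ≤ D.ht v')
    (hy : y ∈ Icc a b) (hz : z ∈ Ioo a b) (hlt : D.edgeX u v y < D.edgeX u' v' y) :
    D.edgeX u v z < D.edgeX u' v' z := by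
  refine lt_of_lt_of_forall_ne (D.continuous_edgeX u v) (D.continuous_edgeX u' v')
    (fun x hx => edgeX_ne_edgeX h h' (fun he => ?_) ⟨ha.trans_lt hx.1, hx.2.trans_le hb⟩
      ⟨ha'.trans_lt hx.1, hx.2.trans_le hb'⟩) hy hz hlt
  obtain ⟨rfl, rfl⟩ := Prod.mk.inj he
  exact hlt.false

theorem OutLeft.adj_left {u v w : V} (h : D.OutLeft u v w) : G.Adj u v := h.1

theorem OutLeft.adj_right {u v w : V} (h : D.OutLeft u v w) : G.Adj u w := h.2.1

/-- `OutLeft` speaks only of heights just above `u`; as edges do not cross, the order persists up to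
the lower of the two heads. -/
theorem OutLeft.edgeX_lt {u v w : V} (h : D.OutLeft u v w) {z : ℝ} (hz : D.ht u < z)
    (hzv : z < D.ht v) (hzw : z < D.ht w) : D.edgeX u v z < D.edgeX u w z := by
  obtain ⟨hv, hw, y, hy, H⟩ := h
  have hy' : D.ht u < y := hy
  obtain ⟨x, hx, hxm⟩ := exists_between (lt_min hy' hz)
  obtain ⟨hxy, hxz⟩ := lt_min_iff.1 hxm
  obtain ⟨s, hs⟩ := exists_curve_eq hv (y := x) ⟨hx.le, by linarith⟩
  obtain ⟨t, ht⟩ := exists_curve_eq hw (y := x) ⟨hx.le, by linarith⟩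
  have := H s t (by rw [hs, ht]) (by rw [hs]; exact ⟨hx, hxy⟩)
  rw [hs, ht] at this
  exact edgeX_lt_edgeX hv hw le_rfl le_rfl (min_le_left _ _) (min_le_right _ _)
    ⟨hx.le, (lt_min (hxz.trans hzv) (hxz.trans hzw)).le⟩ ⟨hz, lt_min hzv hzw⟩ this

theorem OutLeft.ne {u v w : V} (h : D.OutLeft u v w) : v ≠ w := by
  rintro rfl
  obtain ⟨z, hz, hz'⟩ := exists_between (ht_lt (D := D) h.adj_left)
  exact (h.edgeX_lt hz hz' hz').false

theorem OutLeft.asymm {u v w : V} (h : D.OutLeft u v w) : ¬ D.OutLeft u w v := by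
  intro h'
  obtain ⟨z, hz, hz'⟩ := exists_between (lt_min (ht_lt (D := D) h.adj_left) (ht_lt h.adj_right))
  obtain ⟨hzv, hzw⟩ := lt_min_iff.1 hz'
  exact (h.edgeX_lt hz hzv hzw).asymm (h'.edgeX_lt hz hzw hzv)

theorem nodup_of_pairwise_outLeft {u : V} {l : List V} (hl : l.Pairwise (D.OutLeft u)) : l.Nodup :=
  hl.imp OutLeft.ne

theorem outLeft_total {u v w : V} {l : List V} (hl : l.Pairwise (D.OutLeft u)) (hv : v ∈ l)
    (hw : w ∈ l) (hne : v ≠ w) : D.OutLeft u v w ∨ D.OutLeft u w v :=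
  -- Symmetrizing the relation makes it independent of the order in which `v` and `w` occur in the
  -- list.
  have : Std.Symm fun v w => D.OutLeft u v w ∨ D.OutLeft u w v := ⟨fun _ _ => Or.symm⟩
  (hl.imp (S := fun v w => D.OutLeft u v w ∨ D.OutLeft u w v) Or.inl).forall hv hw hne

variable (D)

/-- The horizontal coordinate of a path at a given height. -/
noncomputable def pathX : List V → ℝ → ℝ
  | [], _ => 0
  | [v], _ => D.hor v
  | u :: v :: p, y => if y ≤ D.ht v then D.edgeX u v y else pathX (v :: p) y

variable {D}

theorem pathX_of_le {u : V} {p : List V} (h : (u :: p).IsChain G.Adj) {y : ℝ}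
    (hy : y ≤ D.ht u) : D.pathX (u :: p) y = D.hor u := by
  cases p with
  | nil => rfl
  | cons v p =>
    have huv := (List.isChain_cons_cons.1 h).1
    rw [pathX, if_pos (hy.trans (ht_lt huv).le), edgeX_of_le huv hy]

theorem continuous_pathX : ∀ {p : List V}, p.IsChain G.Adj → Continuous (D.pathX p)
  | [], _ => continuous_const
  | [v], _ => continuous_const
  | u :: v :: p, h => by
    obtain ⟨huv, hp⟩ := List.isChain_cons_cons.1 h
    refine Continuous.if_le (D.continuous_edgeX u v) (continuous_pathX hp) continuous_id
      continuous_const fun y hy => ?_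
    rw [show y = D.ht v from hy, edgeX_top huv, pathX_of_le hp le_rfl]

theorem ht_head_lt {u v : V} {p : List V} (h : (u :: p).IsChain G.Adj) (hv : v ∈ p) :
    D.ht u < D.ht v := by
  have : (u :: p).IsChain (fun a b => D.ht a < D.ht b) := h.imp fun _ _ => ht_lt
  have := List.isChain_iff_pairwise (R := fun a b => D.ht a < D.ht b) |>.1 this
  exact List.rel_of_pairwise_cons this hv

theorem pathX_ht : ∀ {p : List V}, p.IsChain G.Adj → ∀ {v : V}, v ∈ p →
    D.pathX p (D.ht v) = D.hor v
  | [], _, v, hv => by simp at hv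
  | u :: p, h, v, hv => by
    rcases List.mem_cons.1 hv with rfl | hv
    · exact pathX_of_le h le_rfl
    · cases p with
      | nil => simp at hv
      | cons w p =>
        obtain ⟨huw, hp⟩ := List.isChain_cons_cons.1 h
        rw [pathX]
        split_ifs with hle
        · rcases List.mem_cons.1 hv with rfl | hv
          · exact edgeX_top huw
          · exact absurd (ht_head_lt hp hv) hle.not_gt
        · exact pathX_ht hp hv

theorem pathX_edge : ∀ {p : List V}, p.IsChain G.Adj → ∀ {a b : V}, [a, b] <:+: p → ∀ {z : ℝ},
    z ∈ Icc (D.ht a) (D.ht b) → D.pathX p z = D.edgeX a b z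
  | [], _, a, b, hab, z, hz => by simp at hab
  | [u], _, a, b, hab, z, hz => by
    have := hab.length_le; simp at this
  | u :: v :: p, h, a, b, hab, z, hz => by
    obtain ⟨huv, hp⟩ := List.isChain_cons_cons.1 h
    rcases List.infix_cons_iff.1 hab with h1 | h1
    · obtain ⟨rfl, h2⟩ := List.cons_prefix_cons.1 h1
      obtain ⟨rfl, h2⟩ := List.cons_prefix_cons.1 h2
      rw [pathX, if_pos hz.2]
    · have hm : a ∈ v :: p := h1.subset (by simp)
      have hva : D.ht v ≤ D.ht a := by
        rcases List.mem_cons.1 hm with rfl | hm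
        · exact le_rfl
        · exact (ht_head_lt hp hm).le
      have ih := pathX_edge hp h1 hz
      rw [pathX]
      split_ifs with hle
      -- The two branches of `pathX` overlap only at the height of `v`, where both give the position
      -- of `v`.
      · have hzv : z = D.ht v := le_antisymm hle (hva.trans hz.1)
        rw [← ih, hzv, edgeX_top huv, pathX_of_le hp le_rfl]
      · exact ih

theorem exists_edge_of_mem_Ico : ∀ {p : List V}, p.IsChain G.Adj → ∀ {s t : V},
    p.head? = some s → p.getLast? = some t → ∀ {z : ℝ}, z ∈ Ico (D.ht s) (D.ht t) →
    ∃ a b, [a, b] <:+: p ∧ z ∈ Ico (D.ht a) (D.ht b)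
  | [], _, s, t, hs, ht, z, hz => by simp at hs
  | [u], _, s, t, hs, ht, z, hz => by
    simp at hs ht; subst hs; subst ht; exact absurd (hz.1.trans_lt hz.2) (lt_irrefl _)
  | u :: v :: p, h, s, t, hs, ht, z, hz => by
    simp only [List.head?_cons, Option.some.injEq] at hs
    subst hs
    by_cases hv : z < D.ht v
    · exact ⟨u, v, ⟨[], p, rfl⟩, hz.1, hv⟩
    · obtain ⟨a, b, hab, hz'⟩ := exists_edge_of_mem_Ico (List.isChain_cons_cons.1 h).2
        (s := v) (t := t) rfl (by rwa [List.getLast?_cons_cons] at ht) ⟨not_lt.1 hv, hz.2⟩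
      exact ⟨a, b, hab.trans (List.suffix_cons _ _).isInfix, hz'⟩

theorem adj_of_infix {p : List V} (h : p.IsChain G.Adj) {a b : V} (hab : [a, b] <:+: p) :
    G.Adj a b := by
  have := h.infix hab
  simpa using this

/-- At every height in its range, a path passes through a vertex or through the inside of an
edge. -/
theorem exists_vertex_or_edge {p : List V} (h : p.IsChain G.Adj) {s t : V}
    (hs : p.head? = some s) (ht : p.getLast? = some t) {z : ℝ}
    (hz : z ∈ Icc (D.ht s) (D.ht t)) :
    (∃ a ∈ p, D.ht a = z) ∨ ∃ a b, [a, b] <:+: p ∧ z ∈ Ioo (D.ht a) (D.ht b) := by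
  rcases hz.2.lt_or_eq with hlt | rfl
  · obtain ⟨a, b, hab, ha, hb⟩ := exists_edge_of_mem_Ico h hs ht ⟨hz.1, hlt⟩
    rcases ha.lt_or_eq with ha | ha
    · exact .inr ⟨a, b, hab, ha, hb⟩
    · exact .inl ⟨a, hab.subset (by simp), ha⟩
  · exact .inl ⟨t, List.mem_of_getLast? ht, rfl⟩

theorem mem_of_pathX_eq {p : List V} (h : p.IsChain G.Adj) {s t w : V}
    (hs : p.head? = some s) (ht : p.getLast? = some t)
    (hz : D.ht w ∈ Icc (D.ht s) (D.ht t)) (he : D.pathX p (D.ht w) = D.hor w) : w ∈ p := by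
  rcases exists_vertex_or_edge h hs ht hz with ⟨a, ha, haw⟩ | ⟨a, b, hab, hw⟩
  · rw [← haw, pathX_ht h ha] at he
    rwa [← eq_of_ht_hor haw he]
  · rw [pathX_edge h hab (Ioo_subset_Icc_self hw)] at he
    exact absurd he (edgeX_ne_hor (adj_of_infix h hab) hw)

/-- The second alternative cannot be dropped: internally disjoint paths may coincide if they consist
of a single edge. -/
theorem common_vertex_or_edge {p q : List V} (hp : p.IsChain G.Adj) (hq : q.IsChain G.Adj)
    {s t s' t' : V} (hs : p.head? = some s) (ht : p.getLast? = some t)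
    (hs' : q.head? = some s') (ht' : q.getLast? = some t') {z : ℝ}
    (hz : z ∈ Icc (D.ht s) (D.ht t)) (hz' : z ∈ Icc (D.ht s') (D.ht t'))
    (he : D.pathX p z = D.pathX q z) :
    (∃ a ∈ p, a ∈ q ∧ D.ht a = z) ∨
      ∃ a b, [a, b] <:+: p ∧ [a, b] <:+: q ∧ z ∈ Ioo (D.ht a) (D.ht b) := by
  rcases exists_vertex_or_edge hp hs ht hz with ⟨a, ha, rfl⟩ | ⟨a, b, hab, hw⟩
  · rw [pathX_ht hp ha] at he
    exact .inl ⟨a, ha, mem_of_pathX_eq hq hs' ht' hz' he.symm, rfl⟩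
  · rcases exists_vertex_or_edge hq hs' ht' hz' with ⟨a', ha', rfl⟩ | ⟨a', b', hab', hw'⟩
    · rw [pathX_ht hq ha'] at he
      exact .inl ⟨a', mem_of_pathX_eq hp hs ht hz he, ha', rfl⟩
    · rw [pathX_edge hp hab (Ioo_subset_Icc_self hw),
        pathX_edge hq hab' (Ioo_subset_Icc_self hw')] at he
      by_cases hne : (a, b) = (a', b')
      · obtain ⟨rfl, rfl⟩ := Prod.mk.inj hne
        exact .inr ⟨a, b, hab, hab', hw⟩
      · exact absurd he (edgeX_ne_edgeX (adj_of_infix hp hab) (adj_of_infix hq hab') hne hw hw')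

end UpwardDrawing

/-! ### The number of edges of an upward planar digraph -/

namespace UpwardDrawing

variable {V : Type} {G : Digraph V} (D : UpwardDrawing G)

/-- The edges from `u` to `v` and from `u` to `w` are consecutive, the first one to the left. -/
def IsAngle (u v w : V) : Prop :=
  D.OutLeft u v w ∧ ∀ x, D.OutLeft u v x → ¬ D.OutLeft u x w

/-- `z` lies between the edges from `u` to `v` and from `u` to `w`. -/
def InRegion (u v w z : V) : Prop :=
  D.ht u < D.ht z ∧ D.ht z ≤ D.ht v ∧ D.ht z ≤ D.ht w ∧
    D.edgeX u v (D.ht z) ≤ D.hor z ∧ D.hor z ≤ D.edgeX u w (D.ht z)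

/-- `z` is a lowest vertex between the edges from `u` to `v` and from `u` to `w`. -/
def IsLowest (u v w z : V) : Prop :=
  D.InRegion u v w z ∧ ∀ z', D.InRegion u v w z' → D.ht z ≤ D.ht z'

variable {D}

/-- The upper apex `u₂` is below `z`, so it cannot lie in the first wedge, of which `z` is a lowest
vertex. It is thus strictly to one side, and the edges bounding the second wedge stay on that side
up to the height of `z`. -/
theorem IsAngle.disjoint_of_ne {u₁ v₁ w₁ u₂ v₂ w₂ z : V} (h₁ : D.IsAngle u₁ v₁ w₁)
    (h₂ : D.IsAngle u₂ v₂ w₂) (hne : u₁ ≠ u₂) (hle : D.ht u₁ ≤ D.ht u₂)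
    (hz₁ : D.IsLowest u₁ v₁ w₁ z) (hz₂ : D.IsLowest u₂ v₂ w₂ z) {y : ℝ}
    (hy : D.ht u₂ < y) (hyz : y < D.ht z) :
    D.edgeX u₁ w₁ y ≤ D.edgeX u₂ v₂ y ∨ D.edgeX u₂ w₂ y ≤ D.edgeX u₁ v₁ y := by
  obtain ⟨⟨hu₁, hv₁, hw₁, -, -⟩, hlow⟩ := hz₁
  obtain ⟨⟨hu₂, hv₂, hw₂, -, -⟩, -⟩ := hz₂
  have key : D.hor u₂ < D.edgeX u₁ v₁ (D.ht u₂) ∨ D.edgeX u₁ w₁ (D.ht u₂) < D.hor u₂ := by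
    by_contra! hcon
    rcases hle.lt_or_eq with hlt | heq
    · exact (hlow u₂ ⟨hlt, (hu₂.trans_le hv₁).le, (hu₂.trans_le hw₁).le, hcon⟩).not_gt hu₂
    · rw [← heq, edgeX_of_le h₁.1.adj_left le_rfl, edgeX_of_le h₁.1.adj_right le_rfl] at hcon
      exact hne (eq_of_ht_hor heq (le_antisymm hcon.1 hcon.2))
  have hyy : y ∈ Ioo (D.ht u₂) (D.ht z) := ⟨hy, hyz⟩
  have hc : D.ht u₂ ∈ Icc (D.ht u₂) (D.ht z) := ⟨le_rfl, hu₂.le⟩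
  rcases key with h | h
  · refine .inr (edgeX_lt_edgeX h₂.1.adj_right h₁.1.adj_left le_rfl hle hw₂ hv₁ hc hyy ?_).le
    rwa [edgeX_of_le h₂.1.adj_right le_rfl]
  · refine .inl (edgeX_lt_edgeX h₁.1.adj_right h₂.1.adj_left hle le_rfl hw₁ hv₂ hc hyy ?_).le
    rwa [edgeX_of_le h₂.1.adj_left le_rfl]


theorem IsAngle.disjoint {u₁ v₁ w₁ u₂ v₂ w₂ z : V} (h₁ : D.IsAngle u₁ v₁ w₁)
    (h₂ : D.IsAngle u₂ v₂ w₂) (hne : u₁ ≠ u₂) (hz₁ : D.IsLowest u₁ v₁ w₁ z)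
    (hz₂ : D.IsLowest u₂ v₂ w₂ z) {y : ℝ} (hy₁ : D.ht u₁ < y) (hy₂ : D.ht u₂ < y)
    (hyz : y < D.ht z) :
    D.edgeX u₁ w₁ y ≤ D.edgeX u₂ v₂ y ∨ D.edgeX u₂ w₂ y ≤ D.edgeX u₁ v₁ y := by
  rcases le_total (D.ht u₁) (D.ht u₂) with h | h
  · exact h₁.disjoint_of_ne h₂ hne h hz₁ hz₂ hy₂ hyz
  · exact (h₂.disjoint_of_ne h₁ hne.symm h hz₂ hz₁ hy₁ hyz).symm

theorem IsLowest.left_eq_iff {u v w z : V} (h : D.IsAngle u v w) (hz : D.IsLowest u v w z) :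
    D.edgeX u v (D.ht z) = D.hor z ↔ z = v := by
  obtain ⟨⟨hu, hv, -⟩, -⟩ := hz
  constructor
  · intro he
    rcases hv.lt_or_eq with hlt | heq
    · exact absurd he (edgeX_ne_hor h.1.adj_left ⟨hu, hlt⟩)
    · rw [heq, edgeX_top h.1.adj_left] at he
      exact eq_of_ht_hor heq he.symm
  · rintro rfl
    exact edgeX_top h.1.adj_left

theorem IsLowest.right_eq_iff {u v w z : V} (h : D.IsAngle u v w) (hz : D.IsLowest u v w z) :
    D.edgeX u w (D.ht z) = D.hor z ↔ z = w := by
  obtain ⟨⟨hu, -, hw, -⟩, -⟩ := hz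
  constructor
  · intro he
    rcases hw.lt_or_eq with hlt | heq
    · exact absurd he (edgeX_ne_hor h.1.adj_right ⟨hu, hlt⟩)
    · rw [heq, edgeX_top h.1.adj_right] at he
      exact eq_of_ht_hor heq he.symm
  · rintro rfl
    exact edgeX_top h.1.adj_right

/-- The lists of out-neighbours of all vertices, ordered from left to right. -/
structure IsOutList (D : UpwardDrawing G) (out : V → List V) : Prop where
  mem_iff : ∀ u v, v ∈ out u ↔ G.Adj u v
  sorted : ∀ u, (out u).Pairwise (D.OutLeft u)

theorem IsOutList.outLeft_of_ne {out : V → List V} (ho : D.IsOutList out) {u v w : V}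
    (hv : G.Adj u v) (hw : G.Adj u w) (hne : v ≠ w) : D.OutLeft u v w ∨ D.OutLeft u w v :=
  outLeft_total (ho.sorted u) ((ho.mem_iff u v).2 hv) ((ho.mem_iff u w).2 hw) hne

theorem IsOutList.outLeft_of_lt {out : V → List V} (ho : D.IsOutList out) {u v w : V}
    (hv : G.Adj u v) (hw : G.Adj u w) {z : ℝ} (hz : D.ht u < z) (hzv : z < D.ht v)
    (hzw : z < D.ht w) (hlt : D.edgeX u v z < D.edgeX u w z) : D.OutLeft u v w := by
  refine (ho.outLeft_of_ne hv hw fun h => ?_).resolve_right fun h => ?_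
  · subst h; exact hlt.false
  · exact (h.edgeX_lt hz hzw hzv).asymm hlt

theorem IsOutList.angle_le {out : V → List V} (ho : D.IsOutList out) {u v₁ w₁ v₂ w₂ : V}
    (h₁ : D.IsAngle u v₁ w₁) (h₂ : D.OutLeft u v₂ w₂) (h : D.OutLeft u v₁ v₂) {z : ℝ}
    (hz : D.ht u < z) (hw₁ : z < D.ht w₁) (hv₂ : z < D.ht v₂) :
    D.edgeX u w₁ z ≤ D.edgeX u v₂ z := by
  by_cases he : v₂ = w₁
  · rw [he]
  · rcases ho.outLeft_of_ne h₂.adj_left h₁.1.adj_right he with h' | h'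
    · exact absurd h' (h₁.2 _ h)
    · exact (h'.edgeX_lt hz hw₁ hv₂).le

theorem IsOutList.angle_disjoint {out : V → List V} (ho : D.IsOutList out)
    {u₁ v₁ w₁ u₂ v₂ w₂ z : V} (h₁ : D.IsAngle u₁ v₁ w₁) (h₂ : D.IsAngle u₂ v₂ w₂)
    (hne : (u₁, v₁) ≠ (u₂, v₂)) (hz₁ : D.IsLowest u₁ v₁ w₁ z) (hz₂ : D.IsLowest u₂ v₂ w₂ z)
    {y : ℝ} (hy₁ : D.ht u₁ < y) (hy₂ : D.ht u₂ < y) (hyz : y < D.ht z) :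
    D.edgeX u₁ w₁ y ≤ D.edgeX u₂ v₂ y ∨ D.edgeX u₂ w₂ y ≤ D.edgeX u₁ v₁ y := by
  by_cases hu : u₁ = u₂
  · subst hu
    have hv : v₁ ≠ v₂ := fun h => hne (by rw [h])
    obtain ⟨⟨-, hv₁, hw₁, -, -⟩, -⟩ := hz₁
    obtain ⟨⟨-, hv₂, hw₂, -, -⟩, -⟩ := hz₂
    rcases ho.outLeft_of_ne h₁.1.adj_left h₂.1.adj_left hv with h | h
    · exact .inl (ho.angle_le h₁ h₂.1 h hy₁ (hyz.trans_le hw₁) (hyz.trans_le hv₂))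
    · exact .inr (ho.angle_le h₂ h₁.1 h hy₁ (hyz.trans_le hw₂) (hyz.trans_le hv₁))
  · exact h₁.disjoint h₂ hu hz₁ hz₂ hy₁ hy₂ hyz

/-- Injectivity of the charging scheme. Different wedges with the same lowest vertex `z` have
disjoint interiors just below `z`, although at the height of `z` both contain `z`. This is possible
only if `z` is the left head of one wedge and the right head of the other; as the two bits agree,
both heads of one wedge would then be `z`. -/
theorem IsOutList.angle_unique {out : V → List V} (ho : D.IsOutList out)
    {u₁ v₁ w₁ u₂ v₂ w₂ z : V} (h₁ : D.IsAngle u₁ v₁ w₁) (h₂ : D.IsAngle u₂ v₂ w₂)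
    (hz₁ : D.IsLowest u₁ v₁ w₁ z) (hz₂ : D.IsLowest u₂ v₂ w₂ z)
    (hv : z = v₁ ↔ z = v₂) (hw : z = w₁ ↔ z = w₂) : (u₁, v₁) = (u₂, v₂) := by
  by_contra hne
  have a₁ := hz₁.1.2.2.2.1
  have b₁ := hz₁.1.2.2.2.2
  have a₂ := hz₂.1.2.2.2.1
  have b₂ := hz₂.1.2.2.2.2
  have hvw₁ : v₁ ≠ w₁ := h₁.1.ne
  have l₁ : D.edgeX u₁ v₁ (D.ht z) < D.edgeX u₂ w₂ (D.ht z) := by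
    refine lt_of_le_of_ne (a₁.trans b₂) fun he => hvw₁ ?_
    have e₁ := (hz₁.left_eq_iff h₁).1 (le_antisymm a₁ (he ▸ b₂))
    have e₂ := (hz₂.right_eq_iff h₂).1 (le_antisymm (he ▸ a₁) b₂)
    rw [← e₁, ← hw.2 e₂]
  have l₂ : D.edgeX u₂ v₂ (D.ht z) < D.edgeX u₁ w₁ (D.ht z) := by
    refine lt_of_le_of_ne (a₂.trans b₁) fun he => hvw₁ ?_
    have e₁ := (hz₂.left_eq_iff h₂).1 (le_antisymm a₂ (he ▸ b₁))
    have e₂ := (hz₁.right_eq_iff h₁).1 (le_antisymm (he ▸ a₂) b₁)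
    rw [← hv.2 e₁, ← e₂]
  -- The strict inequalities at the height of `z` persist slightly below it, where they say that the
  -- interiors of the wedges overlap.
  have hev := ((D.continuous_edgeX u₁ v₁).continuousAt.eventually_lt
    (D.continuous_edgeX u₂ w₂).continuousAt l₁).and
    (((D.continuous_edgeX u₂ v₂).continuousAt.eventually_lt
    (D.continuous_edgeX u₁ w₁).continuousAt l₂).and
    ((lt_mem_nhds hz₁.1.1).and (lt_mem_nhds hz₂.1.1)))
  obtain ⟨y, ⟨m₁, m₂, hy₁, hy₂⟩, hyz⟩ :=
    ((hev.filter_mono nhdsWithin_le_nhds).and (self_mem_nhdsWithin (s := Iio (D.ht z)))).exists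
  rcases ho.angle_disjoint h₁ h₂ hne hz₁ hz₂ hy₁ hy₂ hyz with h | h <;> linarith

/-- The wedge contains the lower of its two heads, by passing to the limit from below; finiteness
then gives a lowest vertex. -/
theorem IsAngle.exists_isLowest [Finite V] {u v w : V} (h : D.IsAngle u v w) :
    ∃ z, D.IsLowest u v w z := by
  have hne : {z | D.InRegion u v w z}.Nonempty := by
    rcases le_total (D.ht v) (D.ht w) with hle | hle
    · refine ⟨v, ht_lt h.1.adj_left, le_rfl, hle, (edgeX_top h.1.adj_left).le, ?_⟩
      rw [← edgeX_top h.1.adj_left]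
      refine le_of_tendsto_of_tendsto (b := nhdsWithin (D.ht v) (Iio (D.ht v)))
        ((D.continuous_edgeX u v).continuousWithinAt) ((D.continuous_edgeX u w).continuousWithinAt)
        ?_
      filter_upwards [Ioo_mem_nhdsLT (ht_lt (D := D) h.1.adj_left)] with y hy
      exact (h.1.edgeX_lt hy.1 hy.2 (hy.2.trans_le hle)).le
    · refine ⟨w, ht_lt h.1.adj_right, hle, le_rfl, ?_, (edgeX_top h.1.adj_right).ge⟩
      rw [← edgeX_top h.1.adj_right]
      refine le_of_tendsto_of_tendsto (b := nhdsWithin (D.ht w) (Iio (D.ht w)))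
        ((D.continuous_edgeX u v).continuousWithinAt) ((D.continuous_edgeX u w).continuousWithinAt)
        ?_
      filter_upwards [Ioo_mem_nhdsLT (ht_lt (D := D) h.1.adj_right)] with y hy
      exact (h.1.edgeX_lt hy.1 (hy.2.trans_le hle) hy.2).le
  obtain ⟨z, hz, hmin⟩ := Set.exists_min_image _ D.ht (Set.toFinite _) hne
  exact ⟨z, hz, hmin⟩

/-- `OutLeft u` is a strict order on a finite set, so among the edges to the right of a given one
there is a first. -/
theorem IsOutList.exists_isAngle [Finite V] {out : V → List V} (ho : D.IsOutList out) {u v x : V}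
    (h : D.OutLeft u v x) : ∃ w, D.IsAngle u v w := by
  by_contra! hcon
  have key : ∀ w, D.OutLeft u v w → ∃ w', D.OutLeft u v w' ∧ D.OutLeft u w' w := by
    intro w hw
    have := hcon w
    simp only [IsAngle, hw, true_and, not_forall, not_not] at this
    obtain ⟨w', h1, h2⟩ := this
    exact ⟨w', h1, h2⟩
  have hwf : WellFounded fun a b => D.OutLeft u a b := by
    have : Std.Irrefl fun a b => D.OutLeft u a b := ⟨fun a h => h.ne rfl⟩
    have : IsTrans V fun a b => D.OutLeft u a b := ⟨fun a b c hab hbc => by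
      have hac : a ≠ c := by rintro rfl; exact hab.asymm hbc
      refine (ho.outLeft_of_ne hab.adj_left hbc.adj_right hac).resolve_right fun hca => ?_
      obtain ⟨z, hz, hz'⟩ := exists_between (lt_min (ht_lt (D := D) hab.adj_left)
        (lt_min (ht_lt (D := D) hab.adj_right) (ht_lt (D := D) hbc.adj_right)))
      simp only [lt_min_iff] at hz'
      obtain ⟨ha, hb, hc⟩ := hz'
      have h1 := hab.edgeX_lt hz ha hb
      have h2 := hbc.edgeX_lt hz hb hc
      have h3 := hca.edgeX_lt hz hc ha
      linarith⟩
    exact Finite.wellFounded_of_trans_of_irrefl _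
  obtain ⟨w, hw, hmin⟩ := hwf.has_min {w | D.OutLeft u v w} ⟨x, h⟩
  obtain ⟨w', h1, h2⟩ := key w hw
  exact hmin w' h1 h2

/-- An upward planar digraph has at most five times as many edges as vertices. -/
theorem IsOutList.sum_length_le [Fintype V] {out : V → List V} (ho : D.IsOutList out) :
    ∑ u, (out u).length ≤ 5 * Fintype.card V := by
  classical
  rcases isEmpty_or_nonempty V with hV | hV
  · simp
  have hnd : ∀ u, (out u).Nodup := fun u => nodup_of_pairwise_outLeft (ho.sorted u)
  -- The charge of an edge: its tail with `none` if it is the rightmost edge there, and otherwise a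
  -- lowest vertex of the wedge to its right with two bits. Hence each vertex has 1 + 4 possible
  -- charges.
  have key : ∀ e : V × V, G.Adj e.1 e.2 → ∃ c : V × Option (Bool × Bool),
      (c.2 = none ∧ c.1 = e.1 ∧ ∀ x, ¬ D.OutLeft e.1 e.2 x) ∨
      ∃ w, D.IsAngle e.1 e.2 w ∧ D.IsLowest e.1 e.2 w c.1 ∧
        c.2 = some (decide (c.1 = e.2), decide (c.1 = w)) := by
    rintro ⟨u, v⟩ he
    by_cases h : ∃ x, D.OutLeft u v x
    · obtain ⟨x, hx⟩ := h
      obtain ⟨w, hw⟩ := ho.exists_isAngle hx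
      obtain ⟨z, hz⟩ := hw.exists_isLowest
      exact ⟨(z, some (decide (z = v), decide (z = w))), .inr ⟨w, hw, hz, rfl⟩⟩
    · exact ⟨(u, none), .inl ⟨rfl, rfl, not_exists.1 h⟩⟩
  choose! c hc using key
  have hcard : ∑ u, (out u).length =
      (Finset.univ.sigma fun u => (out u).toFinset).card := by
    rw [Finset.card_sigma]
    exact Finset.sum_congr rfl fun u _ => (List.toFinset_card_of_nodup (hnd u)).symm
  have h5 : (Finset.univ : Finset (V × Option (Bool × Bool))).card = 5 * Fintype.card V := by
    rw [Finset.card_univ, Fintype.card_prod, mul_comm]; rfl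
  rw [hcard, ← h5]
  refine Finset.card_le_card_of_injOn (fun e => c (e.1, e.2)) (fun _ _ => Finset.mem_coe.2
    (Finset.mem_univ _)) ?_
  rintro ⟨u₁, v₁⟩ he₁ ⟨u₂, v₂⟩ he₂ hcc
  simp only [Finset.coe_sigma, Set.mem_sigma_iff, Finset.mem_coe, Finset.mem_univ,
    List.mem_toFinset, ho.mem_iff, true_and] at he₁ he₂ hcc
  have hpair : (u₁, v₁) = (u₂, v₂) := by
    rcases hc (u₁, v₁) he₁ with ⟨n₁, a₁, r₁⟩ | ⟨w₁, a₁, l₁, t₁⟩ <;>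
    rcases hc (u₂, v₂) he₂ with ⟨n₂, a₂, r₂⟩ | ⟨w₂, a₂, l₂, t₂⟩
    · rw [← hcc, a₁] at a₂
      dsimp only at a₂ r₁ r₂
      subst a₂
      by_contra hne
      have hv : v₁ ≠ v₂ := fun h => hne (by rw [h])
      rcases ho.outLeft_of_ne he₁ he₂ hv with h | h
      · exact r₁ _ h
      · exact r₂ _ h
    · rw [← hcc, n₁] at t₂; cases t₂
    · rw [hcc, n₂] at t₁; cases t₁
    · rw [← hcc] at l₂ t₂
      rw [t₁] at t₂
      simp only [Option.some.injEq, Prod.mk.injEq, decide_eq_decide] at t₂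
      exact ho.angle_unique a₁ a₂ l₁ l₂ t₂.1 t₂.2
  obtain ⟨rfl, rfl⟩ := Prod.mk.inj hpair
  rfl

end UpwardDrawing

/-! ### Leftmost paths and the greedy order -/

theorem eq_or_eq_or_isInner {V : Type} {G : Digraph V} {s t v : V} {p : List V}
    (h : IsDiPath G s t p) (hv : v ∈ p) : v = s ∨ v = t ∨ IsInner p v := by
  obtain ⟨-, -, hs, ht⟩ := h
  by_cases h1 : v = s
  · exact .inl h1
  by_cases h2 : v = t
  · exact .inr (.inl h2)
  · refine .inr (.inr ⟨hv, ?_, ?_⟩)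
    · rw [hs]; simpa using Ne.symm h1
    · rw [ht]; simpa using Ne.symm h2

/-- Inner vertices of a path differ from its ends. -/
theorem IsInner.ne_ends {V : Type} {G : Digraph V} {s t v : V} {p : List V}
    (h : IsDiPath G s t p) (hv : IsInner p v) : v ≠ s ∧ v ≠ t := by
  obtain ⟨-, -, hs, ht⟩ := h
  obtain ⟨-, h1, h2⟩ := hv
  rw [hs] at h1; rw [ht] at h2
  exact ⟨fun h => h1 (by rw [h]), fun h => h2 (by rw [h])⟩

theorem isDiPath_singleton {V : Type} (G : Digraph V) (s : V) : IsDiPath G s s [s] :=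
  ⟨List.isChain_singleton s, List.nodup_singleton s, rfl, rfl⟩

theorem not_isInner_singleton {V : Type} (s v : V) : ¬ IsInner [s] v := by
  rintro ⟨h, h', -⟩
  simp at h h'
  exact h' h.symm

/-- `p` is a path from `s` to `t` no inner vertex of which is in `B`. -/
def IsAvoidingPath {V : Type} (G : Digraph V) (B : Set V) (s t : V) (p : List V) : Prop :=
  IsDiPath G s t p ∧ ∀ v, IsInner p v → v ∉ B

/-- From the set `K` one can go only to `K` and to blocked vertices other than `t`. -/
def IsDead {V : Type} (G : Digraph V) (B : Set V) (t : V) (K : Set V) : Prop :=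
  ∀ v ∈ K, ∀ w, G.Adj v w → w ≠ t ∧ (w ∈ B ∨ w ∈ K)

/-- The path can never leave `K`: each next vertex is not `t` and hence not blocked, so it is in `K`
again. Blocking is required to fail only behind `x`, because a start vertex may itself be blocked.
-/
theorem IsDead.last_ne {V : Type} {G : Digraph V} {B K : Set V} {t : V} (hK : IsDead G B t K) :
    ∀ {p : List V} {x : V}, (x :: p).IsChain G.Adj → x ∈ K → x ≠ t →
      (∀ v ∈ p, v ≠ t → v ∉ B) → t ∉ x :: p
  | [], x, _, _, hxt, _ => by simpa using hxt.symm
  | y :: p, x, h, hx, hxt, hB => by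
    obtain ⟨hxy, hp⟩ := List.isChain_cons_cons.1 h
    obtain ⟨hy, hy'⟩ := hK x hx y hxy
    have := hK.last_ne hp (hy'.resolve_left (hB y (by simp) hy)) hy fun v hv =>
      hB v (List.mem_cons_of_mem _ hv)
    exact List.not_mem_cons_of_ne_of_not_mem hxt.symm this

theorem IsDead.no_path {V : Type} {G : Digraph V} {B K : Set V} {s t : V} (hK : IsDead G B t K)
    (hs : ∀ w, G.Adj s w → w ≠ t ∧ (w ∈ B ∨ w ∈ K)) (hst : s ≠ t) (p : List V) :
    ¬ IsAvoidingPath G B s t p := by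
  rintro ⟨hp, hB⟩
  have hK' : IsDead G B t (insert s K) := by
    rintro v (rfl | hv) w hw
    · exact ⟨(hs w hw).1, (hs w hw).2.imp_right (Set.mem_insert_of_mem _)⟩
    · exact ⟨(hK v hv w hw).1, (hK v hv w hw).2.imp_right (Set.mem_insert_of_mem _)⟩
  cases p with
  | nil => simp [IsDiPath] at hp
  | cons x p =>
    have hx : x = s := by simpa using hp.2.2.1
    subst hx
    refine hK'.last_ne hp.1 (Set.mem_insert _ _) hst (fun v hv hvt => hB v ?_)
      (List.mem_of_getLast? hp.2.2.2)
    refine ((eq_or_eq_or_isInner hp (List.mem_cons_of_mem _ hv)).resolve_left ?_).resolve_left hvt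
    rintro rfl
    exact (List.nodup_cons.1 hp.2.1).1 hv

namespace UpwardDrawing

variable {V : Type} {G : Digraph V} {D : UpwardDrawing G}

theorem _root_.IsInner.ht_mem {s t v : V} {p : List V} (h : IsDiPath G s t p)
    (hv : IsInner p v) : D.ht v ∈ Ioo (D.ht s) (D.ht t) := by
  obtain ⟨h1, h2⟩ := hv.ne_ends h
  obtain ⟨hc, -, hs, ht⟩ := h
  have hpw : p.Pairwise (fun a b => D.ht a < D.ht b) :=
    (List.isChain_iff_pairwise (R := fun a b => D.ht a < D.ht b)).1 (hc.imp fun _ _ => ht_lt)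
  constructor
  · cases p with
    | nil => simp at hs
    | cons x p =>
      have hx : x = s := by simpa using hs
      subst hx
      exact List.rel_of_pairwise_cons hpw ((List.mem_cons.1 hv.1).resolve_left h1)
  · obtain ⟨q, rfl⟩ := List.getLast?_eq_some_iff.1 ht
    have := (List.pairwise_append.1 hpw).2.2
    exact this v ((List.mem_append.1 hv.1).resolve_right (by simpa using h2)) t (by simp)

theorem _root_.IsDiPath.ht_mem {s t v : V} {p : List V} (h : IsDiPath G s t p) (hv : v ∈ p)
    (hst : D.ht s ≤ D.ht t) : D.ht v ∈ Icc (D.ht s) (D.ht t) := by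
  rcases eq_or_eq_or_isInner h hv with rfl | rfl | hv
  · exact ⟨le_rfl, hst⟩
  · exact ⟨hst, le_rfl⟩
  · exact Ioo_subset_Icc_self (hv.ht_mem h)

theorem nodup_of_isChain {p : List V} (D : UpwardDrawing G)
    (h : p.IsChain G.Adj) : p.Nodup :=
  ((List.isChain_iff_pairwise (R := fun a b => D.ht a < D.ht b)).1
    (h.imp fun _ _ => ht_lt)).imp fun h he => h.ne (by rw [he])

/-- A path that always takes the leftmost edge from which `t` can be reached is to the left of
all other paths with the same ends. -/
theorem IsOutList.pathX_le {out : V → List V} (ho : D.IsOutList out) {B K : Set V} {s t : V}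
    (hK : IsDead G B t K) {p q : List V} (hp : IsDiPath G s t p)
    (hl : p.IsChain fun a b => ∀ w, D.OutLeft a w b → w ≠ t ∧ (w ∈ B ∨ w ∈ K))
    (hq : IsAvoidingPath G B s t q) {z : ℝ} (hz : z ∈ Icc (D.ht s) (D.ht t)) :
    D.pathX p z ≤ D.pathX q z := by
  by_contra! hlt
  obtain ⟨hpc, -, hps, hpt⟩ := hp
  obtain ⟨hqd, hqB⟩ := hq
  obtain ⟨hqc, hqn, hqs, hqt⟩ := id hqd
  have cp := continuous_pathX (D := D) hpc
  have cq := continuous_pathX (D := D) hqc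
  -- Let `y` be the last height up to `z` at which `p` is still weakly left of `q`. There the paths
  -- meet, and right above it `q` is strictly left of `p`.
  have hcomp : IsCompact (Icc (D.ht s) z ∩ {y | D.pathX p y ≤ D.pathX q y}) :=
    isCompact_Icc.inter_right (isClosed_le cp cq)
  obtain ⟨y, ⟨⟨hsy, hyz⟩, hyle⟩, hymax⟩ := hcomp.exists_isGreatest ⟨D.ht s, ⟨le_rfl, hz.1⟩, by
    have h1 := pathX_ht (D := D) hpc (List.mem_of_head? hps)
    have h2 := pathX_ht (D := D) hqc (List.mem_of_head? hqs)
    exact (h1.trans h2.symm).le⟩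
  have hyz' : y < z := lt_of_le_of_ne hyz (by rintro rfl; exact hlt.not_ge hyle)
  have habove : ∀ x, y < x → x ≤ z → D.pathX q x < D.pathX p x := fun x hx hxz => by
    by_contra! h
    exact hx.not_ge (hymax ⟨⟨hsy.trans hx.le, hxz⟩, h⟩)
  have heq : D.pathX p y = D.pathX q y := by
    refine le_antisymm hyle ?_
    refine le_of_tendsto_of_tendsto (b := nhdsWithin y (Ioi y)) cq.continuousWithinAt
      cp.continuousWithinAt ?_
    filter_upwards [Ioo_mem_nhdsGT hyz'] with x hx
    exact (habove x hx.1 hx.2.le).le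
  have hyI : y ∈ Ico (D.ht s) (D.ht t) := ⟨hsy, hyz'.trans_le hz.2⟩
  obtain ⟨a, b, hab, hya, hyb⟩ := exists_edge_of_mem_Ico hpc hps hpt hyI
  obtain ⟨a', b', hab', hya', hyb'⟩ := exists_edge_of_mem_Ico hqc hqs hqt hyI
  have adj := adj_of_infix hpc hab
  have adj' := adj_of_infix hqc hab'
  obtain ⟨x, hyx, hx⟩ := exists_between (lt_min hyz' (lt_min hyb hyb'))
  obtain ⟨hxz, hxb, hxb'⟩ : x < z ∧ x < D.ht b ∧ x < D.ht b' := by simpa using hx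
  have hx1 := habove x hyx hxz.le
  rw [pathX_edge hpc hab ⟨hya.trans hyx.le, hxb.le⟩,
    pathX_edge hqc hab' ⟨hya'.trans hyx.le, hxb'.le⟩] at hx1
  rw [pathX_edge hpc hab ⟨hya, hyb.le⟩, pathX_edge hqc hab' ⟨hya', hyb'.le⟩] at heq
  have hne : (a, b) ≠ (a', b') := by
    intro h
    obtain ⟨rfl, rfl⟩ := Prod.mk.inj h
    exact hx1.false
  -- The paths continue above `y` on different edges, which meet at height `y`; this can happen only
  -- at a common tail.
  rcases hya.lt_or_eq with hya | rfl
  · rcases hya'.lt_or_eq with hya' | rfl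
    · exact edgeX_ne_edgeX adj adj' hne ⟨hya, hyb⟩ ⟨hya', hyb'⟩ heq
    · rw [edgeX_of_le adj' le_rfl] at heq
      exact edgeX_ne_hor adj ⟨hya, hyb⟩ heq
  · rcases hya'.lt_or_eq with hya' | hya'
    · rw [edgeX_of_le adj le_rfl] at heq
      exact edgeX_ne_hor adj' ⟨hya', hyb'⟩ heq.symm
    · rw [edgeX_of_le adj le_rfl, edgeX_of_le adj' hya'.ge] at heq
      have haa := eq_of_ht_hor hya' heq.symm
      subst haa
      have hleft := ho.outLeft_of_lt adj' adj hyx hxb' hxb hx1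
      have hstep : ∀ w, D.OutLeft a' w b → w ≠ t ∧ (w ∈ B ∨ w ∈ K) := by
        simpa using hl.infix hab
      obtain ⟨hbt, hbB⟩ := hstep _ hleft
      have hinner : ∀ v ∈ q, D.ht a' < D.ht v → v ≠ t → v ∉ B := fun v hv hlt hvt => by
        refine hqB v (((eq_or_eq_or_isInner hqd hv).resolve_left ?_).resolve_left hvt)
        rintro rfl
        exact hlt.not_ge hsy
      -- At the common tail, `q` takes an edge that the leftmost rule rejected for `p`. Its head is
      -- not blocked, since `q` avoids `B`, so it lies in the dead set `K` and `q` misses `t`.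
      have hbK := hbB.resolve_left (hinner b' (hab'.subset (by simp)) (ht_lt adj') hbt)
      obtain ⟨l₁, l₂, rfl⟩ := hab'
      have hqc' : (b' :: l₂).IsChain G.Adj := hqc.suffix ⟨l₁ ++ [a'], by simp⟩
      have hmem : ∀ v ∈ l₂, v ∈ l₁ ++ [a', b'] ++ l₂ := fun v hv => by simp [hv]
      refine hK.last_ne hqc' hbK hbt (fun v hv hvt => hinner v (hmem v hv)
        ((ht_lt adj').trans (ht_head_lt hqc' hv)) hvt) ?_
      have : (b' :: l₂).getLast? = some t := by
        rw [← hqt, show l₁ ++ [a', b'] ++ l₂ = (l₁ ++ [a']) ++ (b' :: l₂) by simp,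
          List.getLast?_append_of_ne_nil _ (by simp)]
      exact List.mem_of_getLast? this

/-- At a meeting point strictly inside both ranges, a common vertex would be an inner vertex of `p`,
and a common edge would have to be all of `p`, lying on `q`, against the strict inequality at `y`.
-/
theorem pathX_lt_pathX {s t s' t' : V} {p q : List V} (hp : IsDiPath G s t p)
    (hq : IsDiPath G s' t' q) (hd : InternallyDisjoint p q) {y z : ℝ}
    (hy : y ∈ Ioo (D.ht s) (D.ht t)) (hy' : y ∈ Ioo (D.ht s') (D.ht t'))
    (hz : z ∈ Ioo (D.ht s) (D.ht t)) (hz' : z ∈ Ioo (D.ht s') (D.ht t'))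
    (h : D.pathX p y < D.pathX q y) : D.pathX p z < D.pathX q z := by
  refine lt_of_lt_of_forall_ne (a := max (D.ht s) (D.ht s')) (b := min (D.ht t) (D.ht t'))
    (continuous_pathX hp.1) (continuous_pathX hq.1) (fun x hx he => ?_)
    ⟨(max_lt hy.1 hy'.1).le, (lt_min hy.2 hy'.2).le⟩ ⟨max_lt hz.1 hz'.1, lt_min hz.2 hz'.2⟩ h
  obtain ⟨hx1, hx2⟩ := hx
  obtain ⟨h1, h2⟩ := max_lt_iff.1 hx1
  obtain ⟨h3, h4⟩ := lt_min_iff.1 hx2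
  rcases common_vertex_or_edge hp.1 hq.1 hp.2.2.1 hp.2.2.2 hq.2.2.1 hq.2.2.2 ⟨h1.le, h3.le⟩
    ⟨h2.le, h4.le⟩ he with ⟨a, hap, haq, rfl⟩ | ⟨a, b, habp, habq, -⟩
  · rcases eq_or_eq_or_isInner hp hap with rfl | rfl | hi
    · exact h1.false
    · exact h3.false
    · exact hd.1 a hi haq
  · have hap : a ∈ p := habp.subset (by simp)
    have haq : a ∈ q := habq.subset (by simp)
    have hbp : b ∈ p := habp.subset (by simp)
    have hbq : b ∈ q := habq.subset (by simp)
    have hlt : D.ht a < D.ht b := ht_lt (adj_of_infix hp.1 habp)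
    have hle : D.ht s ≤ D.ht t := (hy.1.trans hy.2).le
    have has : a = s := by
      rcases eq_or_eq_or_isInner hp hap with h | h | hi
      · exact h
      · rw [h] at hlt; exact absurd (hp.ht_mem hbp hle).2 hlt.not_ge
      · exact absurd haq (hd.1 a hi)
    have hbt : b = t := by
      rcases eq_or_eq_or_isInner hp hbp with h | h | hi
      · rw [h] at hlt; exact absurd (hp.ht_mem hap hle).1 hlt.not_ge
      · exact h
      · exact absurd hbq (hd.1 b hi)
    have hyI : y ∈ Icc (D.ht a) (D.ht b) := by
      rw [has, hbt]; exact Ioo_subset_Icc_self hy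
    rw [pathX_edge hp.1 habp hyI, pathX_edge hq.1 habq hyI] at h
    exact h.false

/-! ### The exchange argument for a fixed left-to-right order. -/

variable {k : ℕ}

/-- The pairs from number `i` on can be linked by disjoint paths with no inner vertex in `B` that
are ordered from left to right. -/
def OrderedSolvable (D : UpwardDrawing G) (s t : Fin k → V) (B : Set V) (i : ℕ) : Prop :=
  ∃ p : Fin k → List V, (∀ c, i ≤ c.val → IsAvoidingPath G B (s c) (t c) (p c)) ∧
    ∀ c c', i ≤ c.val → c < c' → InternallyDisjoint (p c) (p c') ∧
      ∀ z ∈ Ioo (D.ht (s c)) (D.ht (t c)), z ∈ Ioo (D.ht (s c')) (D.ht (t c')) →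
        D.pathX (p c) z ≤ D.pathX (p c') z

theorem OrderedSolvable.succ {s t : Fin k → V} {B : Set V} {i : ℕ}
    (h : D.OrderedSolvable s t B i) : D.OrderedSolvable s t B (i + 1) := by
  obtain ⟨p, h1, h2⟩ := h
  exact ⟨p, fun c hc => h1 c (by omega), fun c c' hc => h2 c c' (by omega)⟩

theorem OrderedSolvable.not_dead {s t : Fin k → V} {B K : Set V} {c : Fin k}
    (h : D.OrderedSolvable s t B c) (hst : s c ≠ t c) (hK : IsDead G B (t c) K)
    (hs : ∀ w, G.Adj (s c) w → w ≠ t c ∧ (w ∈ B ∨ w ∈ K)) : False := by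
  obtain ⟨p, h1, -⟩ := h
  exact hK.no_path hs hst _ (h1 c le_rfl)

/-- The old paths are kept; only the new blocked vertices need attention. If `v` is inner for both
`q` and a later `p c'`, then at its height `q ≤ p c ≤ p c'` with equal ends, so `p c` passes through
`v` too, against disjointness from `p c'`. -/
theorem OrderedSolvable.step {out : V → List V} (ho : D.IsOutList out) {s t : Fin k → V}
    {B K : Set V} {c : Fin k} (h : D.OrderedSolvable s t B c)
    (hK : IsDead G B (t c) K) {q : List V}
    (hq : IsAvoidingPath G B (s c) (t c) q)
    (hl : q.IsChain fun a b => ∀ w, D.OutLeft a w b → w ≠ t c ∧ (w ∈ B ∨ w ∈ K)) :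
    D.OrderedSolvable s t (B ∪ {v | IsInner q v}) (c + 1) := by
  obtain ⟨p, h1, h2⟩ := h
  refine ⟨p, fun c' hc' => ⟨(h1 c' (by omega)).1, fun v hv => ?_⟩,
    fun c₁ c₂ hc => h2 c₁ c₂ (by omega)⟩
  rintro (hvB | hvq)
  · exact (h1 c' (by omega)).2 v hv hvB
  · have hlt : c < c' := Fin.lt_def.2 hc'
    obtain ⟨hdis, hle⟩ := h2 c c' le_rfl hlt
    have hvq' : IsInner q v := hvq
    have m1 := hvq'.ht_mem (D := D) hq.1
    have m2 := hv.ht_mem (D := D) (h1 c' (by omega)).1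
    have e1 := ho.pathX_le hK hq.1 hl (h1 c le_rfl) (Ioo_subset_Icc_self m1)
    have e2 := hle _ m1 m2
    rw [pathX_ht hq.1.1 hvq'.1] at e1
    rw [pathX_ht (h1 c' (by omega)).1.1 hv.1] at e2
    obtain ⟨hpc, -, hps, hpt⟩ := (h1 c le_rfl).1
    exact hdis.2 v hv (mem_of_pathX_eq hpc hps hpt (Ioo_subset_Icc_self m1) (le_antisymm e2 e1))

/-- The pairs before number `i` are linked by disjoint paths with all inner vertices in `B`. -/
def PartlySolved (G : Digraph V) (s t : Fin k → V) (B : Set V) (i : ℕ) : Prop :=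
  ∃ p : Fin k → List V, (∀ c, c.val < i → IsDiPath G (s c) (t c) (p c) ∧
    ∀ v, IsInner (p c) v → v ∈ B ∧ ∀ c', v ≠ s c' ∧ v ≠ t c') ∧
    ∀ c c', c.val < i → c'.val < i → c ≠ c' → InternallyDisjoint (p c) (p c')

theorem PartlySolved.zero (s t : Fin k → V) (B : Set V) : PartlySolved G s t B 0 :=
  ⟨fun _ => [], fun _ h => absurd h (Nat.not_lt_zero _), fun _ _ h => absurd h (Nat.not_lt_zero _)⟩

theorem internallyDisjoint_of_inner {s t s' t' : V} {p q : List V} (hp : IsDiPath G s t p)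
    (hq : IsDiPath G s' t' q) (h1 : ∀ v, IsInner p v → v ≠ s' ∧ v ≠ t' ∧ ¬ IsInner q v)
    (h2 : ∀ v, IsInner q v → v ≠ s ∧ v ≠ t) : InternallyDisjoint p q := by
  refine ⟨fun v hv hvq => ?_, fun v hv hvp => ?_⟩
  · obtain ⟨a, b, c⟩ := h1 v hv
    rcases eq_or_eq_or_isInner hq hvq with h | h | h
    exacts [a h, b h, c h]
  · rcases eq_or_eq_or_isInner hp hvp with h | h | h
    exacts [(h2 v hv).1 h, (h2 v hv).2 h, (h1 v h).2.2 hv]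

/-- All terminals and all earlier inner vertices are in `B`, so avoiding `B` gives disjointness from
the earlier paths. -/
theorem PartlySolved.step {s t : Fin k → V} {B : Set V} {c : Fin k}
    (h : PartlySolved G s t B c) (hT : ∀ c, s c ∈ B ∧ t c ∈ B) {q : List V}
    (hq : IsAvoidingPath G B (s c) (t c) q) :
    PartlySolved G s t (B ∪ {v | IsInner q v}) (c + 1) := by
  classical
  obtain ⟨p, h1, h2⟩ := h
  have hqT : ∀ v, IsInner q v → ∀ c', v ≠ s c' ∧ v ≠ t c' := fun v hv c' =>
    ⟨fun h => hq.2 v hv (h ▸ (hT c').1), fun h => hq.2 v hv (h ▸ (hT c').2)⟩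
  have hlt : ∀ c' : Fin k, c' ≠ c → c'.val < c + 1 → c'.val < c := fun c' hne hc' => by
    have := Fin.val_ne_of_ne hne; omega
  have hdis : ∀ c' : Fin k, c'.val < c → InternallyDisjoint (p c') q := fun c' hc' =>
    internallyDisjoint_of_inner (h1 c' hc').1 hq.1
      (fun v hv => ⟨(((h1 c' hc').2 v hv).2 c).1, (((h1 c' hc').2 v hv).2 c).2,
        fun hvq => hq.2 v hvq ((h1 c' hc').2 v hv).1⟩) (fun v hv => hqT v hv c')
  refine ⟨Function.update p c q, fun c' hc' => ?_, fun c₁ c₂ hc₁ hc₂ hne => ?_⟩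
  · by_cases he : c' = c
    · subst he
      rw [Function.update_self]
      exact ⟨hq.1, fun v hv => ⟨.inr hv, hqT v hv⟩⟩
    · rw [Function.update_of_ne he]
      obtain ⟨a, b⟩ := h1 c' (hlt c' he hc')
      exact ⟨a, fun v hv => ⟨.inl (b v hv).1, (b v hv).2⟩⟩
  · by_cases he₁ : c₁ = c
    · have he₂ : c₂ ≠ c := fun h => hne (he₁.trans h.symm)
      rw [he₁, Function.update_self, Function.update_of_ne he₂]
      exact (hdis c₂ (hlt c₂ he₂ hc₂)).symm
    · by_cases he₂ : c₂ = c
      · rw [he₂, Function.update_self, Function.update_of_ne he₁]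
        exact hdis c₁ (hlt c₁ he₁ hc₁)
      · rw [Function.update_of_ne he₁, Function.update_of_ne he₂]
        exact h2 c₁ c₂ (hlt c₁ he₁ hc₁) (hlt c₂ he₂ hc₂) hne

end UpwardDrawing

/-! ### Numbering disjoint paths from left to right. -/

/-- A relation for which the element with the lowest top can be bypassed has a linear order. -/
theorem exists_pairwise_not_swap {ι : Type} {r : ι → ι → Prop} {top : ι → ℝ}
    (hirr : ∀ a, ¬ r a a)
    (hby : ∀ a c b, r a c → r c b → top c ≤ top a → top c ≤ top b → r a b) :
    ∀ l : List ι, l.Pairwise (fun a b => top a ≤ top b) →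
      ∃ l' : List ι, l'.Perm l ∧ l'.Pairwise fun a b => ¬ r b a
  | [], _ => ⟨[], .nil, .nil⟩
  | c :: l, hl => by
    obtain ⟨hc, hl⟩ := List.pairwise_cons.1 hl
    obtain ⟨m, hm, hmp⟩ := exists_pairwise_not_swap hirr hby l hl
    have ins : ∀ m : List ι, (∀ a ∈ m, top c ≤ top a) → m.Pairwise (fun a b => ¬ r b a) →
        ∃ m' : List ι, m'.Perm (c :: m) ∧ m'.Pairwise fun a b => ¬ r b a := by
      intro m
      induction m with
      | nil => exact fun _ _ => ⟨[c], .refl _, List.pairwise_singleton _ _⟩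
      | cons x m ih =>
        intro hcm hp
        obtain ⟨hx, hp'⟩ := List.pairwise_cons.1 hp
        -- `c` is inserted behind the last `a` with `r a c`. If `r c x` held for an `x` at or before
        -- such an `a`, bypassing `c` would give `r a x`, against irreflexivity or the order of `x
        -- :: m`.
        by_cases hex : ∃ a ∈ x :: m, r a c
        · obtain ⟨m', hm', hmp'⟩ := ih (fun a ha => hcm a (List.mem_cons_of_mem _ ha)) hp'
          refine ⟨x :: m', (hm'.cons x).trans (.swap _ _ _), List.pairwise_cons.2
            ⟨fun b hb => ?_, hmp'⟩⟩
          rcases List.mem_cons.1 (hm'.subset hb) with rfl | hb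
          · intro hbx
            obtain ⟨a, ha, hab⟩ := hex
            have hax := hby a b x hab hbx (hcm a ha) (hcm x (by simp))
            rcases List.mem_cons.1 ha with rfl | ha
            · exact hirr _ hax
            · exact hx a ha hax
          · exact hx b hb
        · push Not at hex
          exact ⟨c :: x :: m, .refl _, List.pairwise_cons.2 ⟨hex, hp⟩⟩
    obtain ⟨m', hm', hmp'⟩ := ins m (fun a ha => hc a (hm.subset ha)) hmp
    exact ⟨m', hm'.trans (hm.cons c), hmp'⟩

namespace UpwardDrawing

variable {V : Type} {G : Digraph V} {D : UpwardDrawing G} {k : ℕ}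

/-- Disjoint paths can be numbered from left to right. -/
theorem exists_orderedSolvable {s t : Fin k → V} {p : Fin k → List V}
    (hp : ∀ i, IsDiPath G (s i) (t i) (p i)) (hd : ∀ i j, i ≠ j → InternallyDisjoint (p i) (p j)) :
    ∃ e : Equiv.Perm (Fin k), D.OrderedSolvable (s ∘ e) (t ∘ e) (range s ∪ range t) 0 := by
  let r : Fin k → Fin k → Prop := fun i j => ∃ z ∈ Ioo (D.ht (s i)) (D.ht (t i)),
    z ∈ Ioo (D.ht (s j)) (D.ht (t j)) ∧ D.pathX (p i) z < D.pathX (p j) z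
  let top : Fin k → ℝ := fun i => D.ht (t i)
  have hirr : ∀ a, ¬ r a a := fun a ⟨z, _, _, h⟩ => h.false
  have hby : ∀ a c b, r a c → r c b → top c ≤ top a → top c ≤ top b → r a b := by
    intro a c b hac hcb h1 h2
    have nac : a ≠ c := by rintro rfl; exact hirr _ hac
    have ncb : c ≠ b := by rintro rfl; exact hirr _ hcb
    obtain ⟨x, xa, xc, hx⟩ := hac
    obtain ⟨y, yc, yb, hy⟩ := hcb
    -- Just below the top of `c` all three paths are present: each of `a` and `b` overlaps `c`,
    -- hence starts below its top, and ends no lower.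
    obtain ⟨z, hz, hzt⟩ := exists_between (max_lt (xa.1.trans xc.2)
      (max_lt (xc.1.trans xc.2) (yb.1.trans yc.2)))
    obtain ⟨za, zc, zb⟩ : D.ht (s a) < z ∧ D.ht (s c) < z ∧ D.ht (s b) < z := by simpa using hz
    have l1 := pathX_lt_pathX (hp a) (hp c) (hd a c nac) xa xc ⟨za, hzt.trans_le h1⟩ ⟨zc, hzt⟩ hx
    have l2 := pathX_lt_pathX (hp c) (hp b) (hd c b ncb) yc yb ⟨zc, hzt⟩ ⟨zb, hzt.trans_le h2⟩ hy
    exact ⟨z, ⟨za, hzt.trans_le h1⟩, ⟨zb, hzt.trans_le h2⟩, l1.trans l2⟩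
  classical
  have htot : Std.Total fun a b : Fin k => top a ≤ top b := ⟨fun a b => le_total _ _⟩
  have htr : IsTrans (Fin k) fun a b => top a ≤ top b := ⟨fun a b c => le_trans⟩
  obtain ⟨l, hl, hlp⟩ := exists_pairwise_not_swap hirr hby
    ((List.finRange k).insertionSort fun a b => top a ≤ top b)
    (List.pairwise_insertionSort _ _)
  have hl' : l.Perm (List.finRange k) := hl.trans (List.perm_insertionSort _ _)
  have hlen : l.length = k := by simpa using hl'.length_eq
  have hnd : l.Nodup := hl'.nodup_iff.2 (List.nodup_finRange k)
  let f : Fin k → Fin k := fun i => l[i.val]'(by omega)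
  have hf : Function.Injective f := fun i j hij => Fin.ext ((hnd.getElem_inj_iff).1 hij)
  have hlf : ∀ i j : Fin k, i < j → ¬ r (f j) (f i) := fun i j hij =>
    List.pairwise_iff_getElem.1 hlp i.val j.val (by omega) (by omega) hij
  let e : Equiv.Perm (Fin k) := Equiv.ofBijective f (Finite.injective_iff_bijective.1 hf)
  refine ⟨e, fun i => p (e i), fun c _ => ⟨hp _, fun v hv => ?_⟩, fun c c' _ hc => ⟨?_, ?_⟩⟩
  -- Terminals may be blocked from the outset: an inner vertex of one path lies on no other path, so
  -- it is no terminal.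
  · have hterm : ∀ i, v ≠ s i ∧ v ≠ t i := by
      intro i
      by_cases he : e c = i
      · subst he
        exact hv.ne_ends (hp _)
      · have hv' := (hd _ _ he).1 v hv
        exact ⟨fun h => hv' (h ▸ List.mem_of_head? (hp i).2.2.1),
          fun h => hv' (h ▸ List.mem_of_getLast? (hp i).2.2.2)⟩
    rintro (⟨i, rfl⟩ | ⟨i, rfl⟩)
    exacts [(hterm i).1 rfl, (hterm i).2 rfl]
  · exact hd _ _ (e.injective.ne hc.ne)
  · intro z hz hz'
    by_contra! h
    exact hlf c c' hc ⟨z, hz', hz, h⟩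

end UpwardDrawing

/-! ### Total correctness of programs -/

namespace RAM

infixr:60 " ;; " => Prog.seq

/-- Started in `σ`, the program `p` halts within `T` steps in a state with property `Q`. -/
def Within (p : Prog) (σ : State) (T : ℕ) (Q : State → Prop) : Prop :=
  ∃ t τ, Runs p σ t τ ∧ t ≤ T ∧ Q τ

/-- Whether the program may change register `r`. -/
def Prog.setsReg : Prog → ℕ → Bool
  | .skip, _ => false
  | .const d _, r => r == d
  | .add d _ _, r => r == d
  | .sub d _ _, r => r == d
  | .load d _ _, r => r == d
  | .store _ _ _, _ => false
  | .seq p q, r => p.setsReg r || q.setsReg r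
  | .ite _ p q, r => p.setsReg r || q.setsReg r
  | .loop _ p, r => p.setsReg r

/-- Whether the program may change array `A`. -/
def Prog.setsArr : Prog → ℕ → Bool
  | .store B _ _, A => A == B
  | .seq p q, A => p.setsArr A || q.setsArr A
  | .ite _ p q, A => p.setsArr A || q.setsArr A
  | .loop _ p, A => p.setsArr A
  | _, _ => false

/-- `τ` agrees with `σ` outside the registers and arrays changed by `p`. -/
structure Frame (p : Prog) (σ τ : State) : Prop where
  reg : ∀ r, p.setsReg r = false → τ.reg r = σ.reg r
  arr : ∀ A, p.setsArr A = false → τ.arr A = σ.arr A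

theorem Frame.refl (p : Prog) (σ : State) : Frame p σ σ := ⟨fun _ _ => rfl, fun _ _ => rfl⟩

theorem Frame.trans {p : Prog} {σ τ υ : State} (h : Frame p σ τ) (h' : Frame p τ υ) :
    Frame p σ υ :=
  ⟨fun r hr => (h'.reg r hr).trans (h.reg r hr), fun A hA => (h'.arr A hA).trans (h.arr A hA)⟩

theorem Frame.mono {p q : Prog} {σ τ : State} (h : Frame p σ τ)
    (hr : ∀ r, q.setsReg r = false → p.setsReg r = false)
    (hA : ∀ A, q.setsArr A = false → p.setsArr A = false) : Frame q σ τ :=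
  ⟨fun r h' => h.reg r (hr r h'), fun A h' => h.arr A (hA A h')⟩

theorem frame_setReg {p : Prog} {σ : State} {d x : ℕ} (h : p.setsReg d = true) :
    Frame p σ (σ.setReg d x) := by
  refine ⟨fun r hr => Function.update_of_ne ?_ _ _, fun _ _ => rfl⟩
  rintro rfl
  rw [h] at hr; cases hr

theorem frame_setArr {p : Prog} {σ : State} {A i x : ℕ} (h : p.setsArr A = true) :
    Frame p σ (σ.setArr A i x) := by
  refine ⟨fun _ _ => rfl, fun B hB => Function.update_of_ne ?_ _ _⟩
  rintro rfl
  rw [h] at hB; cases hB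

/-- Which registers and arrays survive a program is read off its syntax, so that preservation facts
reduce to `decide`. -/
theorem Runs.frame {p : Prog} {σ τ : State} {t : ℕ} (h : Runs p σ t τ) : Frame p σ τ := by
  induction h with
  | skip => exact .refl _ _
  | const | add | sub | load => exact frame_setReg (by simp [Prog.setsReg])
  | store => exact frame_setArr (by simp [Prog.setsArr])
  | seq _ _ ih ih' =>
    exact (ih.mono (fun r h => by simp_all [Prog.setsReg]) fun A h => by
      simp_all [Prog.setsArr]).trans
      (ih'.mono (fun r h => by simp_all [Prog.setsReg]) fun A h => by simp_all [Prog.setsArr])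
  | ite_true _ _ ih | ite_false _ _ ih =>
    exact ih.mono (fun r h => by simp_all [Prog.setsReg]) fun A h => by simp_all [Prog.setsArr]
  | loop_false => exact .refl _ _
  | loop_true _ _ _ ih ih' =>
    exact (ih.mono (fun r h => by simp_all [Prog.setsReg]) fun A h => by
      simp_all [Prog.setsArr]).trans ih'

theorem Within.mono {p : Prog} {σ : State} {T T' : ℕ} {Q Q' : State → Prop}
    (h : Within p σ T Q) (hT : T ≤ T') (hQ : ∀ τ, Q τ → Frame p σ τ → Q' τ) :
    Within p σ T' Q' := by
  obtain ⟨t, τ, hr, ht, hq⟩ := h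
  exact ⟨t, τ, hr, ht.trans hT, hQ τ hq hr.frame⟩

theorem Within.seq {p q : Prog} {σ : State} {T T' T'' : ℕ} {R Q : State → Prop}
    (h : Within p σ T R) (h' : ∀ τ, R τ → Frame p σ τ → Within q τ T' Q)
    (hT : T + T' ≤ T'' := by omega) : Within (p ;; q) σ T'' Q := by
  obtain ⟨t, τ, hr, ht, hq⟩ := h
  obtain ⟨t', τ', hr', ht', hq'⟩ := h' τ hq hr.frame
  exact ⟨t + t', τ', hr.seq hr', by omega, hq'⟩

theorem Within.ite {b : Test} {p q : Prog} {σ : State} {T T' : ℕ} {Q : State → Prop}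
    (h : b.Holds σ → Within p σ T Q) (h' : ¬ b.Holds σ → Within q σ T Q)
    (hT : T + 1 ≤ T' := by omega) : Within (.ite b p q) σ T' Q := by
  by_cases hb : b.Holds σ
  · obtain ⟨t, τ, hr, ht, hq⟩ := h hb
    exact ⟨t + 1, τ, .ite_true hb hr, by omega, hq⟩
  · obtain ⟨t, τ, hr, ht, hq⟩ := h' hb
    exact ⟨t + 1, τ, .ite_false hb hr, by omega, hq⟩

/-- A loop whose iterations take at most `c` steps each and decrease a ghost measure. -/
theorem Within.loop {b : Test} {p : Prog} {σ : State} {c m : ℕ} (I : ℕ → State → Prop)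
    (h : ∀ m τ, I m τ → Frame p σ τ → b.Holds τ → Within p τ c fun υ => ∃ m' < m, I m' υ)
    (h0 : I m σ) :
    Within (.loop b p) σ ((c + 1) * m + 1) fun τ => ¬ b.Holds τ ∧ (∃ m' ≤ m, I m' τ) := by
  -- The state is generalized for the induction, keeping the frame relative to the initial `σ`, from
  -- which the loop body recovers its constants.
  have key : ∀ m τ, I m τ → Frame p σ τ →
      Within (.loop b p) τ ((c + 1) * m + 1) fun τ => ¬ b.Holds τ ∧ (∃ m' ≤ m, I m' τ) := by
    intro m
    induction m using Nat.strong_induction_on with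
    | _ m ih =>
      intro τ hI hF
      by_cases hb : b.Holds τ
      · obtain ⟨t, υ, hr, ht, m', hm, hI'⟩ := h m τ hI hF hb
        obtain ⟨t', ρ, hr', ht', hn, m'', hm', hI''⟩ := ih m' hm υ hI' (hF.trans hr.frame)
        refine ⟨t + t' + 1, ρ, .loop_true hb hr hr', ?_, hn, m'', hm'.trans hm.le, hI''⟩
        have : (c + 1) * (m' + 1) ≤ (c + 1) * m := Nat.mul_le_mul_left _ hm
        rw [mul_add] at this
        omega
      · exact ⟨1, τ, .loop_false hb, by omega, hb, m, le_rfl, hI⟩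
  exact key m σ h0 (.refl _ _)

/-- The number of steps of a program without loops. -/
def Prog.cost : Prog → ℕ
  | .seq p q => p.cost + q.cost
  | .ite _ p q => p.cost + q.cost + 1
  | _ => 1

/-- The weakest precondition of a program without loops. -/
def Prog.wp : Prog → (State → Prop) → State → Prop
  | .skip, Q, σ => Q σ
  | .const d c, Q, σ => Q (σ.setReg d c)
  | .add d a b, Q, σ => Q (σ.setReg d (σ.reg a + σ.reg b))
  | .sub d a b, Q, σ => Q (σ.setReg d (σ.reg a - σ.reg b))
  | .load d A i, Q, σ => Q (σ.setReg d (σ.arr A (σ.reg i)))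
  | .store A i a, Q, σ => Q (σ.setArr A (σ.reg i) (σ.reg a))
  | .seq p q, Q, σ => p.wp (q.wp Q) σ
  | .ite b p q, Q, σ => (b.Holds σ → p.wp Q σ) ∧ (¬ b.Holds σ → q.wp Q σ)
  | .loop _ _, _, _ => False

theorem Within.of_wp {p : Prog} {σ : State} {Q : State → Prop} (h : p.wp Q σ) :
    Within p σ p.cost Q := by
  induction p generalizing σ Q with
  | skip => exact ⟨1, _, .skip σ, le_rfl, h⟩
  | const d c => exact ⟨1, _, .const σ d c, le_rfl, h⟩
  | add d a b => exact ⟨1, _, .add σ d a b, le_rfl, h⟩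
  | sub d a b => exact ⟨1, _, .sub σ d a b, le_rfl, h⟩
  | load d A i => exact ⟨1, _, .load σ d A i, le_rfl, h⟩
  | store A i a => exact ⟨1, _, .store σ A i a, le_rfl, h⟩
  | seq p q ihp ihq => exact (ihp h).seq (fun τ hτ _ => ihq hτ) le_rfl
  | ite b p q ihp ihq =>
    exact Within.ite (T := p.cost + q.cost) (fun hb => (ihp (h.1 hb)).mono (by omega)
      fun _ h _ => h) (fun hb => (ihq (h.2 hb)).mono (by omega) fun _ h _ => h) le_rfl
  | loop => exact h.elim

@[simp] theorem setReg_reg (σ : State) (d x r : ℕ) :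
    (σ.setReg d x).reg r = if r = d then x else σ.reg r :=
  Function.update_apply _ _ _ _

@[simp] theorem setReg_arr (σ : State) (d x : ℕ) : (σ.setReg d x).arr = σ.arr := rfl

@[simp] theorem setArr_reg (σ : State) (A i x : ℕ) : (σ.setArr A i x).reg = σ.reg := rfl

@[simp] theorem setArr_arr (σ : State) (A i x B : ℕ) :
    (σ.setArr A i x).arr B = if B = A then Function.update (σ.arr A) i x else σ.arr B :=
  Function.update_apply _ _ _ _

/-- Repeat `body` while register `i` runs from `0` to the content of register `N`. Register `3`
must contain `1`. -/
def forUp (i N : ℕ) (body : Prog) : Prog :=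
  .const i 0 ;; .loop (.lt i N) (body ;; .add i i 3)

/-- Each round costs the body plus one test and one increment; the 2 pays for the initialization and
the final test. -/
theorem within_forUp {i N c n T : ℕ} {body : Prog} {σ : State} (I : ℕ → State → Prop)
    (h3 : σ.reg 3 = 1) (hN : σ.reg N = n) (h0 : I 0 (σ.setReg i 0))
    (h : ∀ j τ, j < n → τ.reg i = j → I j τ → Frame (forUp i N body) σ τ →
      Within body τ c fun υ => I (j + 1) (υ.setReg i (j + 1)))
    (hi : body.setsReg i = false := by decide)
    (hN' : (forUp i N body).setsReg N = false := by decide)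
    (h3' : (forUp i N body).setsReg 3 = false := by decide)
    (hT : (c + 2) * n + 2 ≤ T := by omega) :
    Within (forUp i N body) σ T (I n) := by
  have hset : ∀ r, (body ;; Prog.add i i 3).setsReg r = (forUp i N body).setsReg r := fun r => by
    simp only [forUp, Prog.setsReg]; cases (r == i) <;> simp
  have harr : ∀ A, (body ;; Prog.add i i 3).setsArr A = (forUp i N body).setsArr A := fun A => by
    simp [forUp, Prog.setsArr]
  have hF0 : Frame (forUp i N body) σ (σ.setReg i 0) :=
    frame_setReg (by simp [forUp, Prog.setsReg])
  have hmono : ∀ {τ υ}, Frame (body ;; Prog.add i i 3) τ υ → Frame (forUp i N body) τ υ :=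
    fun hF => hF.mono (fun r hr => (hset r).trans hr) fun A hA => (harr A).trans hA
  refine (Within.of_wp (p := .const i 0) (Q := fun τ => τ = σ.setReg i 0) rfl).seq
    (T' := (c + 2) * n + 1) (fun τ hτ _ => ?_) (by simpa [Prog.cost] using by omega)
  subst hτ
  refine (Within.loop (c := c + 1) (m := n)
    (fun m τ => ∃ j, j + m = n ∧ τ.reg i = j ∧ I j τ) ?_ ⟨0, by simp, by simp, h0⟩).mono
    le_rfl ?_
  · rintro m τ ⟨j, hj, hji, hI⟩ hF hb
    have hF' := hF0.trans (hmono hF)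
    have hlt : j < n := by
      have := hF'.reg N hN'
      rw [hN] at this
      simpa [Test.Holds, this, hji] using hb
    refine (h j τ hlt hji hI hF').seq (T' := 1) (fun υ hυ hFυ => ?_) le_rfl
    refine (Within.of_wp (p := .add i i 3)
      (Q := fun ρ => ρ = υ.setReg i (υ.reg i + υ.reg 3)) rfl).mono le_rfl fun ρ hρ hFρ => ?_
    have e1 : υ.reg i = j := (hFυ.reg i hi).trans hji
    have e2 : υ.reg 3 = 1 := by
      have b3 : body.setsReg 3 = false := by
        have := h3'
        rw [← hset] at this
        simp only [Prog.setsReg, Bool.or_eq_false_iff] at this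
        exact this.1
      rw [hFυ.reg 3 b3, hF'.reg 3 h3', h3]
    rw [e1, e2] at hρ
    subst hρ
    exact ⟨m - 1, by omega, j + 1, by omega, by simp, hυ⟩
  · rintro τ ⟨hb, m', hm', j, hj, hji, hI⟩ hF
    have hF' := hF0.trans (hF.mono (q := forUp i N body)
      (fun r hr => by rw [← hset] at hr; simpa [Prog.setsReg] using hr)
      fun A hA => by rw [← harr] at hA; simpa [Prog.setsArr] using hA)
    have : τ.reg N = n := (hF'.reg N hN').trans hN
    have : ¬ j < n := by simpa [Test.Holds, this, hji] using hb
    obtain rfl : j = n := by omega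
    exact hI

end RAM

/-! ### Depth first search for the leftmost path -/

/-- The state of a depth first search from `s` for `t` that must not enter `B`: the stack is
`x :: r`, the set of abandoned vertices is `K`, and the first `pt v` edges leaving `v` are done. -/
structure SearchState {V : Type} (G : Digraph V) (out : V → List V) (B : Set V) (s t : V)
    (K : Set V) (pt : V → ℕ) (x : V) (r : List V) : Prop where
  dead : IsDead G B t K
  chain : (x :: r).IsChain fun b a =>
    ∃ l, (out a).take (pt a) = l ++ [b] ∧ ∀ w ∈ l, w ≠ t ∧ (w ∈ B ∨ w ∈ K)
  top : ∀ w ∈ (out x).take (pt x), w ≠ t ∧ (w ∈ B ∨ w ∈ K)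
  last : (x :: r).getLast? = some s
  avoid : ∀ v ∈ x :: r, v ≠ s → v ∉ B
  le : ∀ v, pt v ≤ (out v).length
  fresh : ∀ v, v ∉ K → v ∉ x :: r → pt v = 0

namespace SearchState

open UpwardDrawing

variable {V : Type} {G : Digraph V} {D : UpwardDrawing G} {out : V → List V}
  {B : Set V} {s t : V} {K : Set V} {pt : V → ℕ} {x : V} {r : List V}

theorem init (G : Digraph V) (out : V → List V) (s t : V) (B : Set V) :
    SearchState G out B s t ∅ (fun _ => 0) s [] where
  dead := fun _ hv => hv.elim
  chain := List.isChain_singleton _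
  top := by simp
  last := rfl
  avoid := by simp
  le := fun _ => Nat.zero_le _
  fresh := fun _ _ _ => rfl

theorem adj_chain (ho : D.IsOutList out) (h : SearchState G out B s t K pt x r) :
    (x :: r).IsChain fun b a => G.Adj a b :=
  h.chain.imp fun b a ⟨l, hl, _⟩ => (ho.mem_iff a b).1 (List.mem_of_mem_take (by
    rw [hl]; simp : b ∈ (out a).take (pt a)))

theorem ht_lt_top (ho : D.IsOutList out) (h : SearchState G out B s t K pt x r) :
    ∀ v ∈ r, D.ht v < D.ht x := fun _ hv =>
  List.rel_of_pairwise_cons ((List.isChain_iff_pairwise (R := fun b a => D.ht a < D.ht b)).1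
    ((h.adj_chain ho).imp fun _ _ => ht_lt)) hv

theorem adj_next (ho : D.IsOutList out) (hlt : pt x < (out x).length) :
    G.Adj x (out x)[pt x] := (ho.mem_iff _ _).1 (List.getElem_mem hlt)

theorem next_not_mem (ho : D.IsOutList out) (h : SearchState G out B s t K pt x r)
    (hlt : pt x < (out x).length) : (out x)[pt x] ∉ x :: r := by
  intro hm
  have hh := ht_lt (D := D) (adj_next ho hlt)
  rcases List.mem_cons.1 hm with h1 | h1
  · rw [h1] at hh; exact hh.false
  · exact hh.asymm (h.ht_lt_top ho _ h1)

/-- The vertices below `x` on the stack have smaller heights, so none of them is `x` and their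
pointers are untouched. -/
theorem chain_update [DecidableEq V] (ho : D.IsOutList out)
    (h : SearchState G out B s t K pt x r) (m : ℕ) : (x :: r).IsChain fun b a =>
    ∃ l, (out a).take (Function.update pt x m a) = l ++ [b] ∧
      ∀ w ∈ l, w ≠ t ∧ (w ∈ B ∨ w ∈ K) := by
  have hx : ∀ v ∈ r, v ≠ x := fun v hv he => by
    have := h.ht_lt_top ho v hv
    rw [he] at this; exact this.false
  refine List.IsChain.imp_of_mem_tail_imp (fun b a _ ha => ?_) h.chain
  rw [Function.update_of_ne (hx a ha)]
  exact id

theorem skip [DecidableEq V] (ho : D.IsOutList out) (h : SearchState G out B s t K pt x r)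
    (hlt : pt x < (out x).length) (hne : (out x)[pt x] ≠ t)
    (hm : (out x)[pt x] ∈ B ∨ (out x)[pt x] ∈ K) :
    SearchState G out B s t K (Function.update pt x (pt x + 1)) x r where
  dead := h.dead
  chain := h.chain_update ho _
  top := by
    intro w hw
    rw [Function.update_self, List.take_add_one, List.mem_append] at hw
    rcases hw with hw | hw
    · exact h.top w hw
    · rw [List.getElem?_eq_getElem hlt] at hw
      obtain rfl : w = (out x)[pt x] := by simpa using hw
      exact ⟨hne, hm⟩
  last := h.last
  avoid := h.avoid
  le := fun v => by
    by_cases hv : v = x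
    · subst hv; rw [Function.update_self]; exact hlt
    · rw [Function.update_of_ne hv]; exact h.le v
  fresh := fun v hv hv' => by
    rw [Function.update_of_ne fun he => hv' (by simp [he])]; exact h.fresh v hv hv'

theorem push [DecidableEq V] (ho : D.IsOutList out) (h : SearchState G out B s t K pt x r)
    (hlt : pt x < (out x).length) (hB : (out x)[pt x] ∉ B) (hK : (out x)[pt x] ∉ K) :
    SearchState G out B s t K (Function.update pt x (pt x + 1)) (out x)[pt x] (x :: r) where
  dead := h.dead
  chain := by
    refine List.isChain_cons_cons.2 ⟨⟨(out x).take (pt x), ?_, h.top⟩, h.chain_update ho _⟩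
    rw [Function.update_self, List.take_add_one, List.getElem?_eq_getElem hlt]; rfl
  top := by
    have hn := h.next_not_mem ho hlt
    -- A vertex that is neither abandoned nor on the stack has not been scanned yet, so its pointer
    -- is 0 and nothing is claimed about its edges.
    rw [Function.update_of_ne fun he => hn (by simp [he]), h.fresh _ hK hn]
    simp
  last := by rw [List.getLast?_cons_cons]; exact h.last
  avoid := by
    intro v hv hvs
    rcases List.mem_cons.1 hv with rfl | hv
    · exact hB
    · exact h.avoid v hv hvs
  le := fun v => by
    by_cases hv : v = x
    · subst hv; rw [Function.update_self]; exact hlt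
    · rw [Function.update_of_ne hv]; exact h.le v
  fresh := fun v hv hv' => by
    have hv'' : v ∉ x :: r := fun hm => hv' (List.mem_cons_of_mem _ hm)
    rw [Function.update_of_ne fun he => hv'' (by simp [he])]; exact h.fresh v hv hv''

theorem top_done (ho : D.IsOutList out) (h : SearchState G out B s t K pt x r)
    (hge : (out x).length ≤ pt x) (w : V) (hw : G.Adj x w) : w ≠ t ∧ (w ∈ B ∨ w ∈ K) := by
  refine h.top w ?_
  rw [List.take_of_length_le hge]
  exact (ho.mem_iff x w).2 hw

/-- All edges leaving `x` lead to blocked or abandoned vertices other than `t`, so `x` may join the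
dead set. The edge from `y` to `x` thereby becomes a useless one, as `x` is not `t`: stack vertices
other than `s` avoid `B`, which contains `t`. -/
theorem pop (ho : D.IsOutList out) {y : V} (h : SearchState G out B s t K pt x (y :: r))
    (hs : s ∈ B) (ht : t ∈ B) (hge : (out x).length ≤ pt x) :
    SearchState G out B s t (insert x K) pt y r := by
  have hxs : x ≠ s := by
    rintro rfl
    have hl : (y :: r).getLast? = some x := by rw [← h.last, List.getLast?_cons_cons]
    exact (h.ht_lt_top ho x (List.mem_of_getLast? hl)).false
  have hxB : x ∉ B := h.avoid x (by simp) hxs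
  have hxt : x ≠ t := by rintro rfl; exact hxB ht
  obtain ⟨⟨l, hl, hl'⟩, hc⟩ := List.isChain_cons_cons.1 h.chain
  have hmono : ∀ w, w ≠ t ∧ (w ∈ B ∨ w ∈ K) → w ≠ t ∧ (w ∈ B ∨ w ∈ insert x K) := fun w hw =>
    ⟨hw.1, hw.2.imp_right (Set.mem_insert_of_mem _)⟩
  constructor
  · rintro v (rfl | hv) w hw
    · exact hmono w (h.top_done ho hge w hw)
    · exact hmono w (h.dead v hv w hw)
  · exact hc.imp fun b a ⟨l, hl, hl'⟩ => ⟨l, hl, fun w hw => hmono w (hl' w hw)⟩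
  · intro w hw
    rw [hl, List.mem_append] at hw
    rcases hw with hw | hw
    · exact hmono w (hl' w hw)
    · obtain rfl : w = x := by simpa using hw
      exact ⟨hxt, .inr (Set.mem_insert _ _)⟩
  · rw [← h.last, List.getLast?_cons_cons]
  · exact fun v hv => h.avoid v (List.mem_cons_of_mem _ hv)
  · exact h.le
  · intro v hv hv'
    refine h.fresh v (fun hvK => hv (Set.mem_insert_of_mem _ hvK)) fun hm => ?_
    rcases List.mem_cons.1 hm with rfl | hm
    · exact hv (Set.mem_insert _ _)
    · exact hv' hm

/-- When the search meets `t`, the stack is the leftmost path. -/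
theorem path (ho : D.IsOutList out) (h : SearchState G out B s t K pt x r)
    (ht : t ∈ B) (hlt : pt x < (out x).length) (hnext : (out x)[pt x] = t) :
    IsAvoidingPath G B s t (t :: x :: r).reverse ∧
    (t :: x :: r).reverse.IsChain (fun a b => ∀ w, D.OutLeft a w b → w ≠ t ∧ (w ∈ B ∨ w ∈ K)) ∧
    ∀ v, IsInner (t :: x :: r).reverse v ↔ v ∈ x :: r ∧ v ≠ s := by
  have hadj : (t :: x :: r).IsChain fun b a => G.Adj a b :=
    List.isChain_cons_cons.2 ⟨hnext ▸ adj_next ho hlt, h.adj_chain ho⟩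
  have hc : (t :: x :: r).reverse.IsChain G.Adj := List.isChain_reverse.2 hadj
  have hlast : (t :: x :: r).getLast? = some s := by rw [List.getLast?_cons_cons, h.last]
  have hd : IsDiPath G s t (t :: x :: r).reverse :=
    ⟨hc, nodup_of_isChain D hc, by rw [List.head?_reverse, hlast],
      by rw [List.getLast?_reverse]; rfl⟩
  have hin : ∀ v, IsInner (t :: x :: r).reverse v ↔ v ∈ x :: r ∧ v ≠ s := by
    intro v
    constructor
    · intro hv
      obtain ⟨h1, h2⟩ := hv.ne_ends hd
      have := hv.1
      rw [List.mem_reverse, List.mem_cons] at this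
      exact ⟨this.resolve_left h2, h1⟩
    · rintro ⟨h1, h2⟩
      have hvt : v ≠ t := by
        rintro rfl
        exact h.avoid v h1 h2 ht
      exact ((eq_or_eq_or_isInner hd (List.mem_reverse.2
        (List.mem_cons_of_mem _ h1))).resolve_left h2).resolve_left hvt
  refine ⟨⟨hd, fun v hv => h.avoid v ((hin v).1 hv).1 ((hin v).1 hv).2⟩, ?_, hin⟩
  rw [List.isChain_reverse]
  -- The out-lists are sorted, so every edge to the left of the one to `b` comes before it in the
  -- list and has been scanned.
  have key : ∀ (a b : V) (l m : List V), out a = l ++ b :: m →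
      ∀ w, D.OutLeft a w b → w ∈ l := by
    intro a b l m hout w hw
    have hs := ho.sorted a
    have hm := (ho.mem_iff a w).2 hw.adj_left
    rw [hout] at hs hm
    rcases List.mem_append.1 hm with hm | hm
    · exact hm
    · rcases List.mem_cons.1 hm with rfl | hm
      · exact absurd rfl hw.ne
      · exact absurd (List.rel_of_pairwise_cons (List.pairwise_append.1 hs).2.1 hm) hw.asymm
  refine List.isChain_cons_cons.2 ⟨fun w hw => h.top w
      (key x t _ ((out x).drop (pt x + 1)) ?_ w hw),
    h.chain.imp fun b a ⟨l, hl, hl'⟩ w hw => hl' w (key a b l ((out a).drop (pt a)) ?_ w hw)⟩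
  · rw [← hnext, List.cons_getElem_drop_succ, List.take_append_drop]
  · rw [List.append_cons, ← hl, List.take_append_drop]

end SearchState

/-! ### The search as a program -/

/-- The array `E` contains the lists `out v` one after the other, `st` the starting positions. -/
structure IsAdjacencyArray {n : ℕ} (out : Fin n → List (Fin n)) (st E : ℕ → ℕ) : Prop where
  succ : ∀ v : Fin n, st (v + 1) = st v + (out v).length
  get : ∀ (v : Fin n) (i : ℕ) (h : i < (out v).length), E (st v + i) = (out v)[i]

/-- The array `S` contains the stack `l`. -/
def IsStack {n : ℕ} (S : ℕ → ℕ) : List (Fin n) → Prop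
  | [] => True
  | x :: l => S l.length = x ∧ IsStack S l

theorem IsStack.update {n : ℕ} {S : ℕ → ℕ} {i y : ℕ} : ∀ {l : List (Fin n)}, IsStack S l →
    l.length ≤ i → IsStack (Function.update S i y) l
  | [], _, _ => trivial
  | x :: l, h, hi => by
    rw [List.length_cons] at hi
    refine ⟨?_, h.2.update (by omega)⟩
    rw [Function.update_of_ne (by omega)]
    exact h.1

/-- The number of edges that a search has not yet looked at. -/
def remaining {n : ℕ} (out : Fin n → List (Fin n)) (pt : Fin n → ℕ) : ℕ :=
  ∑ v, ((out v).length - pt v)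

theorem remaining_update {n : ℕ} {out : Fin n → List (Fin n)} {pt : Fin n → ℕ} {x : Fin n}
    (h : pt x < (out x).length) :
    remaining out (Function.update pt x (pt x + 1)) + 1 = remaining out pt := by
  unfold remaining
  rw [← Finset.add_sum_erase _ _ (Finset.mem_univ x),
    ← Finset.add_sum_erase _ (fun v => (out v).length - pt v) (Finset.mem_univ x)]
  have : ∑ v ∈ Finset.univ.erase x, ((out v).length - Function.update pt x (pt x + 1) v) =
      ∑ v ∈ Finset.univ.erase x, ((out v).length - pt v) :=
    Finset.sum_congr rfl fun v hv => by rw [Function.update_of_ne (Finset.ne_of_mem_erase hv)]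
  rw [this]
  simp only [Function.update_self]
  omega

namespace RAM

/-- Initialize the visited marks by the blocked vertices and all edge pointers. -/
def initSearch : Prog :=
  forUp 10 0 (.load 11 6 10 ;; .store 7 10 11 ;; .load 11 2 10 ;; .store 8 10 11)

/-- One step of the depth first search. -/
def searchStep : Prog :=
  .load 15 9 13 ;; .load 16 8 15 ;; .add 17 15 3 ;; .load 17 2 17 ;;
  .ite (.lt 16 17)
    (.load 18 3 16 ;; .add 16 16 3 ;; .store 8 15 16 ;;
      .ite (.eq 18 12) (.const 14 0 ;; .const 20 1)
        (.load 19 7 18 ;;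
          .ite (.eq 19 2) (.store 7 18 3 ;; .add 13 13 3 ;; .store 9 13 18) .skip))
    (.ite (.eq 13 2) (.const 14 0) (.sub 13 13 3))

/-- Block all vertices on the stack. -/
def markStack : Prog :=
  .add 13 13 3 ;; .loop (.lt 2 13) (.sub 13 13 3 ;; .load 18 9 13 ;; .store 6 18 3)

/-- Search for the leftmost path from the vertex in register `21` to the one in register `12`; if
there is a path, block its vertices, and otherwise set register `5` to `0`. -/
def search : Prog :=
  initSearch ;; (.const 13 0 ;; .store 9 13 21 ;; .const 14 1 ;; .const 20 0) ;;
  .loop (.eq 14 3) searchStep ;; .ite (.eq 20 3) markStack (.const 5 0)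

theorem within_initSearch {σ : State} {n : ℕ} (h0 : σ.reg 0 = n) (h3 : σ.reg 3 = 1) :
    Within initSearch σ (6 * n + 2)
      fun τ => ∀ v < n, τ.arr 7 v = σ.arr 6 v ∧ τ.arr 8 v = σ.arr 2 v := by
  refine within_forUp (c := 4)
    (fun j τ => ∀ v < j, τ.arr 7 v = σ.arr 6 v ∧ τ.arr 8 v = σ.arr 2 v) h3 h0 (by simp) ?_
  intro j τ _ hj hI hF
  have e6 := hF.arr 6 (by decide)
  have e2 := hF.arr 2 (by decide)
  refine Within.of_wp ?_
  simp [Prog.wp, hj, e6, e2, Function.update_apply]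
  intro v hv
  by_cases h : v = j
  · simp [h]
  · simpa [h] using hI v (by omega)

variable {n : ℕ} {G : Digraph (Fin n)} {D : UpwardDrawing G} {out : Fin n → List (Fin n)}
  {st E : ℕ → ℕ} {B : Set (Fin n)} {s t : Fin n}

/-- The state `τ` of the machine represents a state of a depth first search. -/
structure Represents (st : ℕ → ℕ) (B : Set (Fin n)) (K : Set (Fin n)) (pt : Fin n → ℕ) (x : Fin n)
    (r : List (Fin n)) (τ : State) : Prop where
  depth : τ.reg 13 = r.length
  stack : IsStack (τ.arr 9) (x :: r)
  ptr : ∀ v : Fin n, τ.arr 8 v = st v + pt v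
  vis : ∀ v : Fin n, τ.arr 7 v = 0 ↔ ¬ (v ∈ B ∨ v ∈ K ∨ v ∈ x :: r)

/-- The search has found a path, which is on the stack. -/
def Found (G : Digraph (Fin n)) (out : Fin n → List (Fin n)) (B : Set (Fin n)) (s t : Fin n)
    (τ : State) : Prop :=
  ∃ K pt x r, SearchState G out B s t K pt x r ∧ τ.reg 13 = r.length ∧
    IsStack (τ.arr 9) (x :: r) ∧ ∃ h : pt x < (out x).length, (out x)[pt x] = t

/-- There is no path. -/
def Hopeless (G : Digraph (Fin n)) (B : Set (Fin n)) (s t : Fin n) : Prop :=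
  ∃ K, IsDead G B t K ∧ ∀ w, G.Adj s w → w ≠ t ∧ (w ∈ B ∨ w ∈ K)

/-- The invariant of the search, with a bound `m` on the number of remaining steps. -/
def SearchInv (G : Digraph (Fin n)) (out : Fin n → List (Fin n)) (st : ℕ → ℕ) (B : Set (Fin n))
    (s t : Fin n) (m : ℕ) (τ : State) : Prop :=
  (τ.reg 14 = 1 ∧ τ.reg 20 = 0 ∧ ∃ K pt x r, SearchState G out B s t K pt x r ∧
    Represents st B K pt x r τ ∧ m = 2 * remaining out pt + r.length + 1) ∨
  (τ.reg 14 = 0 ∧ τ.reg 20 = 1 ∧ m = 0 ∧ Found G out B s t τ) ∨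
  (τ.reg 14 = 0 ∧ τ.reg 20 = 0 ∧ m = 0 ∧ Hopeless G B s t)

/-- The potential `2 * remaining + r.length + 1` drops in every step: scanning an edge lowers it by
2, of which a push returns 1; a pop lowers it by 1; success or failure sets it to 0. -/
theorem within_searchStep (ho : D.IsOutList out) (hE : IsAdjacencyArray out st E) {τ : State}
    (e2 : τ.arr 2 = st) (e3 : τ.arr 3 = E) (h2 : τ.reg 2 = 0) (h3 : τ.reg 3 = 1)
    (ht : τ.reg 12 = t) (hs : s ∈ B) (htB : t ∈ B) {m : ℕ}
    (h14 : τ.reg 14 = 1) (hI : SearchInv G out st B s t m τ) :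
    Within searchStep τ searchStep.cost fun υ => ∃ m' < m, SearchInv G out st B s t m' υ := by
  rcases hI with ⟨-, h20, K, pt, x, r, hS, hR, rfl⟩ | ⟨h, -⟩ | ⟨h, -⟩
  rotate_left
  · omega
  · omega
  have hx : τ.arr 9 (τ.reg 13) = x := by rw [hR.depth]; exact hR.stack.1
  have hp := hR.ptr x
  have hend : st (x + 1) = st x + (out x).length := hE.succ x
  refine Within.of_wp ?_
  by_cases hlt : pt x < (out x).length
  · have hw : E (st x + pt x) = (out x)[pt x] := hE.get x _ hlt
    have hrem := remaining_update hlt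
    have hnot := hS.next_not_mem ho hlt
    set w := (out x)[pt x] with hwdef
    -- The target has to be recognized before the visited marks are consulted, because it is blocked
    -- itself.
    by_cases hwt : w = t
    · have hwt' : (w : ℕ) = t := by rw [hwt]
      simp [searchStep, Prog.wp, Test.Holds, hx, h3, hp, e2, e3, hend, hlt, hw, ht, hwt']
      exact ⟨0, by omega, .inr (.inl ⟨by simp, by simp, rfl, K, pt, x, r, hS, by
        simpa using hR.depth, by simpa using hR.stack, hlt, hwt⟩)⟩
    · have hwt' : (w : ℕ) ≠ t := fun h => hwt (Fin.ext h)
      have hptr : ∀ v : Fin n, Function.update (τ.arr 8) x (st x + pt x + 1) v =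
          st v + Function.update pt x (pt x + 1) v := fun v => by
        by_cases hv : v = x
        · subst hv; simp [add_assoc]
        · rw [Function.update_of_ne (fun h => hv (Fin.ext h)), Function.update_of_ne hv]
          exact hR.ptr v
      by_cases hvis : τ.arr 7 w = 0
      · have hnv := (hR.vis w).1 hvis
        push Not at hnv
        simp [searchStep, Prog.wp, Test.Holds, hx, h2, h3, hp, e2, e3, hend, hlt, hw, ht, hwt',
          hvis]
        refine ⟨2 * remaining out (Function.update pt x (pt x + 1)) + (x :: r).length + 1, by
          rw [List.length_cons]; omega, .inl ⟨by simpa using h14, by simpa using h20, K, _, w,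
          x :: r, hS.push ho hlt hnv.1 hnv.2.1, ⟨?_, ?_, ?_, ?_⟩, rfl⟩⟩
        · simp [hR.depth]
        · refine ⟨by simp [hR.depth], ?_⟩
          simpa [hR.depth] using hR.stack.update (i := r.length + 1) (y := w) le_rfl
        · simpa using hptr
        · intro v
          by_cases hv : v = w
          · subst hv; simp
          · have hv' : (v : ℕ) ≠ w := fun h => hv (Fin.ext h)
            have := hR.vis v
            simpa [Function.update_of_ne hv', hv] using this
      · have hv : w ∈ B ∨ w ∈ K := by
          have := mt (hR.vis w).2 hvis
          rw [not_not] at this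
          rcases this with h | h | h
          exacts [.inl h, .inr h, absurd h hnot]
        simp [searchStep, Prog.wp, Test.Holds, hx, h2, h3, hp, e2, e3, hend, hlt, hw, ht, hwt',
          hvis]
        exact ⟨2 * remaining out (Function.update pt x (pt x + 1)) + r.length + 1, by omega,
          .inl ⟨by simpa using h14, by simpa using h20, K, _, x, r, hS.skip ho hlt hwt hv,
          ⟨by simpa using hR.depth, by simpa using hR.stack, by simpa using hptr,
          by simpa using hR.vis⟩, rfl⟩⟩
  · cases r with
    | nil =>
      have hd : τ.reg 13 = 0 := hR.depth
      rw [hd] at hx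
      simp [searchStep, Prog.wp, Test.Holds, hx, h2, h3, hp, e2, hend, hlt, hd]
      have hxs : x = s := by simpa using hS.last
      subst hxs
      exact ⟨0, by omega, .inr (.inr ⟨by simp, by simpa using h20, rfl, K, hS.dead,
        hS.top_done ho (not_lt.1 hlt)⟩)⟩
    | cons y r =>
      have hd : τ.reg 13 = r.length + 1 := hR.depth
      rw [hd] at hx
      simp [searchStep, Prog.wp, Test.Holds, hx, h2, h3, hp, e2, hend, hlt, hd]
      refine ⟨2 * remaining out pt + r.length + 1, by simp, .inl ⟨by simpa using h14,
        by simpa using h20, insert x K, pt, y, r, hS.pop ho hs htB (not_lt.1 hlt),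
        ⟨by simp, by simpa using hR.stack.2, by simpa using hR.ptr, fun v => ?_⟩, rfl⟩⟩
      have := hR.vis v
      simp only [setReg_arr, this, List.mem_cons, Set.mem_insert_iff]
      tauto

theorem within_markStack {τ : State} {l : List (Fin n)} (h2 : τ.reg 2 = 0) (h3 : τ.reg 3 = 1)
    (hd : τ.reg 13 + 1 = l.length) (hl : IsStack (τ.arr 9) l) :
    Within markStack τ (4 * l.length + 2) fun υ =>
      ∀ v : Fin n, υ.arr 6 v ≠ 0 ↔ τ.arr 6 v ≠ 0 ∨ v ∈ l := by
  -- Register `13` holds the index of the stack top; adding 1 gives the length, so that the loop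
  -- also treats cell 0.
  refine (Within.of_wp (p := .add 13 13 3)
    (Q := fun υ => υ = τ.setReg 13 (τ.reg 13 + τ.reg 3)) rfl).seq
    (T' := 4 * l.length + 1) (fun υ hυ _ => ?_) (by simpa [Prog.cost] using by omega)
  subst hυ
  refine (Within.loop (σ := τ.setReg 13 (τ.reg 13 + τ.reg 3)) (c := 3) (m := l.length)
    (fun m υ => υ.reg 13 = m ∧ ∃ l', l'.length = m ∧ IsStack (τ.arr 9) l' ∧
      ∀ v : Fin n, (υ.arr 6 v ≠ 0 → τ.arr 6 v ≠ 0 ∨ v ∈ l) ∧ (τ.arr 6 v ≠ 0 → υ.arr 6 v ≠ 0) ∧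
        (v ∈ l → v ∈ l' ∨ υ.arr 6 v ≠ 0) ∧ (v ∈ l' → v ∈ l)) ?_
    ⟨?_, l, rfl, hl, fun v => ⟨.inl, id, .inl, id⟩⟩).mono le_rfl ?_
  · rintro m υ ⟨hm, l', hlen, hl', hv⟩ hF hb
    have e2 : υ.reg 2 = 0 := by rw [hF.reg 2 (by decide)]; simpa using h2
    have e3 : υ.reg 3 = 1 := by rw [hF.reg 3 (by decide)]; simpa using h3
    have e9 : υ.arr 9 = τ.arr 9 := by rw [hF.arr 9 (by decide)]; rfl
    simp only [Test.Holds, e2, hm] at hb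
    obtain ⟨m, rfl⟩ := Nat.exists_eq_succ_of_ne_zero hb.ne'
    cases l' with
    | nil => simp at hlen
    | cons y l' =>
      obtain ⟨hy, hl''⟩ := hl'
      obtain rfl : l'.length = m := by simpa using hlen
      refine (Within.of_wp (p := .sub 13 13 3 ;; .load 18 9 13 ;; .store 6 18 3) ?_)
      simp only [Prog.wp]
      refine ⟨l'.length, Nat.lt_succ_self _, by simp [hm, e3], l', rfl, hl'', fun v => ?_⟩
      have hyl : y ∈ l := (hv y).2.2.2 (by simp)
      obtain ⟨a, b, c, d⟩ := hv v
      have hnew : ∀ ρ : State, ρ.arr 6 = Function.update (υ.arr 6) y 1 →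
          ρ.arr 6 v = if v = y then 1 else υ.arr 6 v := fun ρ hρ => by
        rw [hρ, Function.update_apply]
        simp only [Fin.ext_iff]
      rw [hnew _ (by simp [hm, e3, e9, hy])]
      by_cases hvy : v = y
      · rw [if_pos hvy, hvy]
        exact ⟨fun _ => .inr hyl, fun _ => one_ne_zero, fun _ => .inr one_ne_zero, fun _ => hyl⟩
      · rw [if_neg hvy]
        refine ⟨a, b, fun h => ?_, fun h => d (List.mem_cons_of_mem _ h)⟩
        rcases c h with h | h
        · exact .inl ((List.mem_cons.1 h).resolve_left hvy)
        · exact .inr h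
  · rw [setReg_reg, if_pos rfl, h3, hd]
  · rintro υ ⟨hb, m', hm', hm, l', hlen, -, hv⟩ hF v
    have e2 : υ.reg 2 = 0 := by rw [hF.reg 2 (by decide)]; simpa using h2
    simp only [Test.Holds, e2, hm] at hb
    have : l' = [] := List.eq_nil_of_length_eq_zero (by omega)
    subst this
    obtain ⟨a, b, c, d⟩ := hv v
    exact ⟨a, fun h => h.elim b fun h => (c h).resolve_left (by simp)⟩

end RAM

namespace RAM

variable {n : ℕ} {G : Digraph (Fin n)} {D : UpwardDrawing G} {out : Fin n → List (Fin n)}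
  {st E : ℕ → ℕ} {s t : Fin n}

/-- The vertices that are marked as blocked. -/
def blocked (n : ℕ) (τ : State) : Set (Fin n) := {v | τ.arr 6 v ≠ 0}

/-- The search has found the leftmost path and has blocked its inner vertices. -/
def LeftmostBlocked (D : UpwardDrawing G) (s t : Fin n) (σ τ : State) : Prop :=
  ∃ K q, IsDead G (blocked n σ) t K ∧ IsAvoidingPath G (blocked n σ) s t q ∧
    (q.IsChain fun a b => ∀ w, D.OutLeft a w b → w ≠ t ∧ (w ∈ blocked n σ ∨ w ∈ K)) ∧
    blocked n τ = blocked n σ ∪ {v | IsInner q v}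

theorem within_search (ho : D.IsOutList out) (hE : IsAdjacencyArray out st E) {σ : State}
    (e2 : σ.arr 2 = st) (e3 : σ.arr 3 = E) (h0 : σ.reg 0 = n) (h2 : σ.reg 2 = 0)
    (h3 : σ.reg 3 = 1) (hs : σ.reg 21 = s) (ht : σ.reg 12 = t) (hsB : s ∈ blocked n σ)
    (htB : t ∈ blocked n σ) :
    Within search σ (400 * n) fun τ =>
      (τ.reg 5 = σ.reg 5 ∧ LeftmostBlocked D s t σ τ) ∨
      (τ.reg 5 = 0 ∧ blocked n τ = blocked n σ ∧ Hopeless G (blocked n σ) s t) := by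
  have hn : 0 < n := s.pos
  -- The linear bound on the number of edges is what makes the search linear in `n`. As `n` is
  -- positive, additive constants are absorbed in `400 * n`.
  have hrem : remaining out (fun _ => 0) ≤ 5 * n := by
    simpa [remaining] using ho.sum_length_le
  have hcost : searchStep.cost = 20 := by decide
  refine (within_initSearch h0 h3).seq (T' := 390 * n - 4) (fun τ₁ hτ₁ hF₁ => ?_)
  refine (Within.of_wp (p := .const 13 0 ;; .store 9 13 21 ;; .const 14 1 ;; .const 20 0)
    (Q := SearchInv G out st (blocked n σ) s t (2 * remaining out (fun _ => 0) + 1)) ?_).seq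
    (T' := 390 * n - 8) (fun τ₂ hτ₂ hF₂ => ?_) (by
      simp only [Prog.cost]; omega)
  · have h21 : τ₁.reg 21 = s := by rw [hF₁.reg 21 (by decide), hs]
    have h6 : τ₁.arr 6 = σ.arr 6 := hF₁.arr 6 (by decide)
    simp only [Prog.wp]
    refine .inl ⟨by simp, by simp, ∅, fun _ => 0, s, [], SearchState.init G out s t _,
      ⟨by simp, ⟨by simp [h21], trivial⟩, fun v => ?_, fun v => ?_⟩, by simp⟩
    · simpa [e2] using (hτ₁ v v.2).2
    · have : τ₁.arr 7 v = σ.arr 6 v := (hτ₁ v v.2).1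
      simp only [setReg_arr, setArr_arr]
      rw [if_neg (by decide), this]
      -- The start vertex is on the stack and must count as visited; it does, being blocked.
      by_cases hvs : v = s
      · subst hvs
        simpa [blocked] using hsB
      · simp [blocked, hvs]
  have hF₁₂ : ∀ r, search.setsReg r = false → τ₂.reg r = σ.reg r := fun r hr => by
    simp only [search, Prog.setsReg, Bool.or_eq_false_iff] at hr
    rw [hF₂.reg r (by simp [Prog.setsReg, hr]), hF₁.reg r hr.1]
  have a2 : τ₂.arr 2 = st := by rw [hF₂.arr 2 (by decide), hF₁.arr 2 (by decide), e2]
  have a3 : τ₂.arr 3 = E := by rw [hF₂.arr 3 (by decide), hF₁.arr 3 (by decide), e3]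
  have a6 : τ₂.arr 6 = σ.arr 6 := by rw [hF₂.arr 6 (by decide), hF₁.arr 6 (by decide)]
  have r2 : τ₂.reg 2 = 0 := by rw [hF₁₂ 2 (by decide), h2]
  have r3 : τ₂.reg 3 = 1 := by rw [hF₁₂ 3 (by decide), h3]
  have r5 : τ₂.reg 5 = σ.reg 5 := by rw [hF₂.reg 5 (by decide), hF₁.reg 5 (by decide)]
  have r12 : τ₂.reg 12 = t := by rw [hF₁₂ 12 (by decide), ht]
  refine (Within.loop (c := searchStep.cost) (SearchInv G out st (blocked n σ) s t)
    (fun m τ hI hF hb => ?_) hτ₂).seq (T' := 10 * n) (fun τ₃ hτ₃ hF₃ => ?_) (by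
      rw [hcost]; omega)
  · have q3 : τ.reg 3 = 1 := by rw [hF.reg 3 (by decide), r3]
    exact within_searchStep ho hE (by rw [hF.arr 2 (by decide), a2])
      (by rw [hF.arr 3 (by decide), a3]) (by rw [hF.reg 2 (by decide), r2]) q3
      (by rw [hF.reg 12 (by decide), r12]) hsB htB (by rw [← q3]; exact hb) hI
  have q2 : τ₃.reg 2 = 0 := by rw [hF₃.reg 2 (by decide), r2]
  have q3 : τ₃.reg 3 = 1 := by rw [hF₃.reg 3 (by decide), r3]
  have q5 : τ₃.reg 5 = σ.reg 5 := by rw [hF₃.reg 5 (by decide), r5]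
  have q6 : τ₃.arr 6 = σ.arr 6 := by rw [hF₃.arr 6 (by decide), a6]
  obtain ⟨hb, m', -, hI⟩ := hτ₃
  have h14 : τ₃.reg 14 ≠ 1 := fun h => hb (by rw [Test.Holds, h, q3])
  refine Within.ite (T := 10 * n - 1) (fun hb => ?_) (fun hb => ?_)
  · have h20 : τ₃.reg 20 = 1 := by rw [Test.Holds, q3] at hb; exact hb
    rcases hI with ⟨h, -⟩ | ⟨-, -, -, hf⟩ | ⟨-, h, -⟩
    · exact absurd h h14
    · obtain ⟨K, pt, x, r, hS, hd, hst, hlt, hnext⟩ := hf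
      obtain ⟨hp, hl, hin⟩ := hS.path ho htB hlt hnext
      -- The stack is a path without repetitions, so marking it takes linear time.
      have hlen : (x :: r).length ≤ n := by
        have hnd : (t :: x :: r).Nodup := List.nodup_reverse.1 hp.1.2.1
        simpa using (List.nodup_cons.1 hnd).2.length_le_card
      refine (within_markStack q2 q3 (l := x :: r) (by rw [hd, List.length_cons]) hst).mono
        (by omega) fun τ₄ hτ₄ hF₄ => .inl ⟨by rw [hF₄.reg 5 (by decide), q5],
          K, _, hS.dead, hp, hl, ?_⟩
      ext v
      have := hτ₄ v
      rw [q6] at this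
      simp only [blocked, Set.mem_ofPred_eq, Set.mem_union, this, hin]
      constructor
      · rintro (h | h)
        · exact .inl h
        -- Marking the whole stack also marks `s`, which is blocked already; the new marks are
        -- exactly the inner vertices.
        · by_cases hvs : v = s
          · exact .inl (hvs ▸ hsB)
          · exact .inr ⟨h, hvs⟩
      · rintro (h | h)
        exacts [.inl h, .inr h.1]
    · omega
  · have h20 : τ₃.reg 20 ≠ 1 := fun h => hb (by rw [Test.Holds, q3, h])
    rcases hI with ⟨h, -⟩ | ⟨-, h, -⟩ | ⟨-, -, -, hf⟩
    · exact absurd h h14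
    · exact absurd h h20
    · refine (Within.of_wp (p := .const 5 0) (Q := fun τ => τ = τ₃.setReg 5 0) rfl).mono
        (by simp only [Prog.cost]; omega) fun τ hτ _ => .inr ⟨by simp [hτ], by simp [blocked, hτ, q6], hf⟩

end RAM

/-! ### The greedy algorithm for a fixed order of the pairs -/

namespace RAM

/-- Block exactly the ends of all pairs. -/
def initBlocked : Prog :=
  forUp 10 0 (.store 6 10 2) ;;
  forUp 10 1 (.load 11 0 10 ;; .store 6 11 3 ;; .load 11 1 10 ;; .store 6 11 3)

/-- Link the pair whose number is at position `reg 7` of array `10`. -/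
def greedyStep : Prog :=
  .load 22 10 7 ;; .load 21 0 22 ;; .load 12 1 22 ;; .ite (.eq 21 12) .skip search

/-- Link all pairs in the order given by array `10`; register `5` tells whether this succeeded. -/
def greedy : Prog := .const 5 1 ;; forUp 7 1 greedyStep

variable {n k : ℕ}

theorem within_initBlocked {σ : State} {s t : Fin k → Fin n} (h0 : σ.reg 0 = n)
    (h1 : σ.reg 1 = k) (h2 : σ.reg 2 = 0) (h3 : σ.reg 3 = 1) (hs : ∀ c : Fin k, σ.arr 0 c = s c)
    (ht : ∀ c : Fin k, σ.arr 1 c = t c) :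
    Within initBlocked σ (3 * n + 6 * k + 4) fun τ => blocked n τ = range s ∪ range t := by
  refine (within_forUp (T := 3 * n + 2) (c := 1) (fun j τ => ∀ v < j, τ.arr 6 v = 0) h3 h0
    (by simp) (fun j τ _ hj hI hF => Within.of_wp ?_)).seq (T' := 6 * k + 2) fun τ hτ hF => ?_
  · have e2 : τ.reg 2 = 0 := by rw [hF.reg 2 (by decide), h2]
    simp [Prog.wp, hj, e2, Function.update_apply]
    exact fun v hv hne => hI v (by omega)
  refine (within_forUp (T := 6 * k + 2) (c := 4) (n := k) (fun j τ => ∀ v : Fin n, τ.arr 6 v ≠ 0 ↔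
      ∃ c : Fin k, c.val < j ∧ (s c = v ∨ t c = v))
    (by rw [hF.reg 3 (by decide), h3]) (by rw [hF.reg 1 (by decide), h1])
    (fun v => by simp [hτ v v.2]) (fun j υ hjk hj hI hF' => Within.of_wp ?_)).mono le_rfl
    fun υ hυ _ => ?_
  · have e0 : υ.arr 0 j = s ⟨j, hjk⟩ := by
      rw [hF'.arr 0 (by decide), hF.arr 0 (by decide)]; exact hs ⟨j, hjk⟩
    have e1 : υ.arr 1 j = t ⟨j, hjk⟩ := by
      rw [hF'.arr 1 (by decide), hF.arr 1 (by decide)]; exact ht ⟨j, hjk⟩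
    have e3 : υ.reg 3 = 1 := by rw [hF'.reg 3 (by decide), hF.reg 3 (by decide), h3]
    simp only [Prog.wp]
    intro v
    have hnew : ∀ ρ : State, ρ.arr 6 = Function.update (Function.update (υ.arr 6) (s ⟨j, hjk⟩) 1)
        (t ⟨j, hjk⟩) 1 → (ρ.arr 6 v ≠ 0 ↔ υ.arr 6 v ≠ 0 ∨ s ⟨j, hjk⟩ = v ∨ t ⟨j, hjk⟩ = v) :=
      fun ρ hρ => by
        rw [hρ, Function.update_apply, Function.update_apply]
        simp only [Fin.ext_iff]
        split_ifs with h h' <;> simp [h] <;> omega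
    rw [hnew _ (by simp [hj, e0, e1, e3]), hI]
    constructor
    · rintro (⟨c, hc, h⟩ | h)
      · exact ⟨c, by omega, h⟩
      · exact ⟨⟨j, hjk⟩, Nat.lt_succ_self j, h⟩
    · rintro ⟨c, hc, h⟩
      rcases Nat.lt_succ_iff_lt_or_eq.1 hc with hc | rfl
      · exact .inl ⟨c, hc, h⟩
      · exact .inr h
  · ext v
    simp only [blocked, Set.mem_ofPred_eq, hυ v, Set.mem_union, Set.mem_range]
    constructor
    · rintro ⟨c, -, h | h⟩
      exacts [.inl ⟨c, h⟩, .inr ⟨c, h⟩]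
    · rintro (⟨c, h⟩ | ⟨c, h⟩)
      exacts [⟨c, c.2, .inl h⟩, ⟨c, c.2, .inr h⟩]

open UpwardDrawing

variable {G : Digraph (Fin n)} {D : UpwardDrawing G} {out : Fin n → List (Fin n)}
  {st E : ℕ → ℕ} {s t : Fin k → Fin n}

/-- The invariant of the greedy algorithm: `P` implies that it is still on the way to success. -/
structure GreedyInv (D : UpwardDrawing G) (s t : Fin k → Fin n) (P : Prop) (j : ℕ) (τ : State) :
    Prop where
  ends : ∀ c, s c ∈ blocked n τ ∧ t c ∈ blocked n τ
  sound : τ.reg 5 ≠ 0 → PartlySolved G s t (blocked n τ) j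
  complete : P → τ.reg 5 = 1 ∧ D.OrderedSolvable s t (blocked n τ) j

theorem GreedyInv.of_eq {P : Prop} {j : ℕ} {σ τ : State} (h : GreedyInv D s t P j σ)
    (h5 : τ.reg 5 = σ.reg 5) (h6 : τ.arr 6 = σ.arr 6) : GreedyInv D s t P j τ := by
  have hb : blocked n τ = blocked n σ := by simp only [blocked, h6]
  exact ⟨hb ▸ h.ends, by rw [h5, hb]; exact h.sound, by rw [h5, hb]; exact h.complete⟩

/-- Success of the search extends both halves of the invariant. Failure exhibits a dead set, which
refutes `P`, and makes soundness vacuous. A pair with equal ends is linked by a single vertex,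
without inner vertices, and needs no search. -/
theorem within_greedyStep (ho : D.IsOutList out) {σ : State}
    (hE : IsAdjacencyArray out (σ.arr 2) (σ.arr 3)) (h0 : σ.reg 0 = n) (h2 : σ.reg 2 = 0)
    (h3 : σ.reg 3 = 1) (hs : ∀ c : Fin k, σ.arr 0 (σ.arr 10 c) = s c)
    (ht : ∀ c : Fin k, σ.arr 1 (σ.arr 10 c) = t c) {P : Prop} {c : Fin k} (h7 : σ.reg 7 = c)
    (hI : GreedyInv D s t P c σ) :
    Within greedyStep σ (400 * n + 4) (GreedyInv D s t P (c + 1)) := by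
  have hload : Within (.load 22 10 7 ;; .load 21 0 22 ;; .load 12 1 22) σ 3 fun τ =>
      τ.reg 21 = s c ∧ τ.reg 12 = t c := Within.of_wp (by simp [Prog.wp, h7, hs, ht])
  have hn := (s c).pos
  -- Sequencing is nested to the right; regrouping lets the three loads be treated as one block, at
  -- the same cost.
  suffices Within ((.load 22 10 7 ;; .load 21 0 22 ;; .load 12 1 22) ;;
      .ite (.eq 21 12) .skip search) σ (400 * n + 4) (GreedyInv D s t P (c + 1)) by
    obtain ⟨T, τ, hr, hT, hτ⟩ := this
    cases hr with
    | seq hr hr' =>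
      cases hr with
      | seq ha hr =>
        cases hr with
        | seq hb hc => exact ⟨_, τ, ha.seq (hb.seq (hc.seq hr')), by omega, hτ⟩
  refine hload.seq (T' := 400 * n + 1) fun τ ⟨h21, h12⟩ hF => ?_
  have hI' : GreedyInv D s t P c τ := hI.of_eq (hF.reg 5 (by decide)) (hF.arr 6 (by decide))
  refine Within.ite (T := 400 * n) (fun hb => ?_) (fun hb => ?_)
  · have hst : s c = t c := Fin.ext (by rw [Test.Holds, h21, h12] at hb; exact hb)
    refine (Within.of_wp (p := .skip) (Q := fun υ => υ = τ) rfl).mono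
      (by simp only [Prog.cost]; omega) fun υ hυ _ => ?_
    subst hυ
    have hq : IsAvoidingPath G (blocked n υ) (s c) (t c) [s c] := by
      rw [← hst]
      exact ⟨isDiPath_singleton G _, fun v hv => absurd hv (not_isInner_singleton _ v)⟩
    have hB : blocked n υ ∪ {v | IsInner [s c] v} = blocked n υ := by
      rw [Set.union_eq_left]
      exact fun v hv => absurd hv (not_isInner_singleton _ v)
    refine ⟨hI'.ends, fun h => ?_, fun h => ⟨(hI'.complete h).1, (hI'.complete h).2.succ⟩⟩
    rw [← hB]
    exact (hI'.sound h).step hI'.ends hq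
  · have hst : s c ≠ t c := fun h => hb (by rw [Test.Holds, h21, h12, h])
    refine (within_search (σ := τ) ho (by
      rw [hF.arr 2 (by decide), hF.arr 3 (by decide)]; exact hE) rfl rfl
      (by rw [hF.reg 0 (by decide), h0]) (by rw [hF.reg 2 (by decide), h2])
      (by rw [hF.reg 3 (by decide), h3]) h21 h12 (hI'.ends c).1 (hI'.ends c).2).mono le_rfl
      fun υ hυ _ => ?_
    rcases hυ with ⟨h5, K, q, hK, hq, hl, hB⟩ | ⟨h5, hB, K, hK, hdead⟩
    · refine ⟨fun c' => ?_, fun h => ?_, fun h => ?_⟩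
      · rw [hB]
        exact ⟨.inl (hI'.ends c').1, .inl (hI'.ends c').2⟩
      · rw [hB]
        exact (hI'.sound (h5 ▸ h)).step hI'.ends hq
      · rw [hB, h5]
        exact ⟨(hI'.complete h).1, (hI'.complete h).2.step ho hK hq hl⟩
    · refine ⟨hB ▸ hI'.ends, fun h => absurd h5 h, fun h => ?_⟩
      exact ((hI'.complete h).2.not_dead hst hK hdead).elim

theorem within_greedy (ho : D.IsOutList out) {σ : State}
    (hE : IsAdjacencyArray out (σ.arr 2) (σ.arr 3)) (h0 : σ.reg 0 = n) (h1 : σ.reg 1 = k)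
    (h2 : σ.reg 2 = 0) (h3 : σ.reg 3 = 1) (hs : ∀ c : Fin k, σ.arr 0 (σ.arr 10 c) = s c)
    (ht : ∀ c : Fin k, σ.arr 1 (σ.arr 10 c) = t c)
    (hB : ∀ c, s c ∈ blocked n σ ∧ t c ∈ blocked n σ) :
    Within greedy σ ((400 * n + 6) * k + 3) fun τ =>
      (τ.reg 5 ≠ 0 → ∃ B, PartlySolved G s t B k) ∧
      (D.OrderedSolvable s t (blocked n σ) 0 → τ.reg 5 = 1) := by
  refine (Within.of_wp (p := .const 5 1) (Q := fun τ => τ = σ.setReg 5 1) rfl).seq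
    (T' := (400 * n + 6) * k + 2) (fun τ hτ _ => ?_) (by simp only [Prog.cost]; omega)
  subst hτ
  refine (within_forUp (σ := σ.setReg 5 1) (T := (400 * n + 6) * k + 2) (c := 400 * n + 4) (n := k)
    (GreedyInv D s t (D.OrderedSolvable s t (blocked n σ) 0)) (by simpa using h3)
    -- The proposition carried along by the invariant is ordered solvability at the start; nothing
    -- is linked yet, so both halves hold trivially.
    (by simpa using h1) ⟨hB, fun _ => PartlySolved.zero _ _ _, fun h => ⟨by simp, h⟩⟩
    (fun j τ hjk hj hI hF => ?_) (hT := le_rfl)).mono le_rfl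
    fun τ hI _ => ⟨fun h => ⟨_, hI.sound h⟩, fun h => (hI.complete h).1⟩
  have a0 : τ.arr 0 = σ.arr 0 := hF.arr 0 (by decide)
  have a1 : τ.arr 1 = σ.arr 1 := hF.arr 1 (by decide)
  have a2 : τ.arr 2 = σ.arr 2 := hF.arr 2 (by decide)
  have a3 : τ.arr 3 = σ.arr 3 := hF.arr 3 (by decide)
  have a10 : τ.arr 10 = σ.arr 10 := hF.arr 10 (by decide)
  have r0 : τ.reg 0 = n := by rw [hF.reg 0 (by decide)]; simpa using h0
  have r2 : τ.reg 2 = 0 := by rw [hF.reg 2 (by decide)]; simpa using h2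
  have r3 : τ.reg 3 = 1 := by rw [hF.reg 3 (by decide)]; simpa using h3
  exact (within_greedyStep ho (c := ⟨j, hjk⟩) (by rw [a2, a3]; exact hE) r0 r2 r3
    (by rw [a0, a10]; exact hs) (by rw [a1, a10]; exact ht) hj hI).mono le_rfl
    fun υ hυ _ => hυ.of_eq (by simp) rfl

end RAM

/-! ### Enumeration of all permutations -/

/-- Digit number `i` of `N` in the factorial number system. -/
def factorialDigit (N i : ℕ) : ℕ := N / i ! % (i + 1)

theorem factorialDigit_le (N i : ℕ) : factorialDigit N i ≤ i :=
  Nat.le_of_lt_succ (Nat.mod_lt _ (Nat.succ_pos i))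

theorem factorialDigit_zero (i : ℕ) : factorialDigit 0 i = 0 := by simp [factorialDigit]

/-- The carry rule: divisibility of `N + 1` by `i !` says that the carry reaches digit `i`, and it
passes on exactly if this digit has its maximal value `i`. -/
theorem factorial_succ_dvd {N i : ℕ} (h : i ! ∣ N + 1) :
    (i + 1)! ∣ N + 1 ↔ factorialDigit N i = i := by
  have hq : (N + 1) / i ! = N / i ! + 1 := Nat.succ_div_of_dvd h
  have h1 : (i + 1)! ∣ N + 1 ↔ i + 1 ∣ N / i ! + 1 := by
    rw [← hq, Nat.factorial_succ, Nat.dvd_div_iff_mul_dvd h, mul_comm]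
  rw [h1, factorialDigit, Nat.dvd_iff_mod_eq_zero]
  have hlt : N / i ! % (i + 1) < i + 1 := Nat.mod_lt _ (Nat.succ_pos i)
  rw [← Nat.mod_add_mod]
  constructor
  · intro h0
    by_contra hne
    rw [Nat.mod_eq_of_lt (by omega)] at h0
    omega
  · intro h0
    rw [h0, Nat.mod_self]

theorem factorialDigit_succ_of_lt {N i v : ℕ} (h : i ! ∣ N + 1) (hv : v < i) :
    factorialDigit (N + 1) v = 0 := by
  have h1 : (v + 1)! ∣ N + 1 := (Nat.factorial_dvd_factorial hv).trans h
  rw [Nat.factorial_succ, mul_comm] at h1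
  exact Nat.mod_eq_zero_of_dvd (Nat.dvd_div_of_mul_dvd h1)

theorem factorialDigit_succ_self {N i : ℕ} (h : i ! ∣ N + 1) (hd : factorialDigit N i < i) :
    factorialDigit (N + 1) i = factorialDigit N i + 1 := by
  unfold factorialDigit at *
  rw [Nat.succ_div_of_dvd h, ← Nat.mod_add_mod, Nat.mod_eq_of_lt (by omega)]

theorem factorialDigit_succ_of_gt {N i v : ℕ} (h : i ! ∣ N + 1) (hd : factorialDigit N i < i)
    (hv : i < v) : factorialDigit (N + 1) v = factorialDigit N v := by
  have h1 : ¬ v ! ∣ N + 1 := fun h' =>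
    hd.ne ((factorial_succ_dvd h).1 ((Nat.factorial_dvd_factorial hv).trans h'))
  rw [factorialDigit, Nat.succ_div_of_not_dvd h1, factorialDigit]

theorem exists_factorialDigit (d : ℕ → ℕ) (hd : ∀ i, d i ≤ i) :
    ∀ k, ∃ N < k !, ∀ i < k, factorialDigit N i = d i
  | 0 => ⟨0, by simp, fun i hi => absurd hi (Nat.not_lt_zero i)⟩
  | k + 1 => by
    obtain ⟨N, hN, h⟩ := exists_factorialDigit d hd k
    -- Adding a multiple of `k !` changes none of the digits below number `k`.
    refine ⟨N + k ! * d k, ?_, fun i hi => ?_⟩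
    · have h1 := Nat.mul_le_mul_left (k !) (hd k)
      have h2 : (k + 1)! = k ! * k + k ! := by rw [Nat.factorial_succ]; ring
      omega
    · rcases Nat.lt_succ_iff_lt_or_eq.1 hi with hi | rfl
      · obtain ⟨c, hc⟩ := Nat.factorial_dvd_factorial (Nat.succ_le_of_lt hi)
        rw [← h i hi, factorialDigit, factorialDigit, hc, Nat.factorial_succ,
          show N + (i + 1) * i ! * c * d k = N + i ! * ((i + 1) * (c * d k)) by ring,
          Nat.add_mul_div_left _ _ (Nat.factorial_pos i), Nat.add_mul_mod_self_left]
      · rw [factorialDigit, Nat.add_mul_div_left _ _ (Nat.factorial_pos i),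
          Nat.div_eq_of_lt hN, zero_add, Nat.mod_eq_of_lt (Nat.lt_succ_of_le (hd i))]

/-- The permutation of the numbers below `k` with digits `d`. -/
def digitPerm (d : ℕ → ℕ) : ℕ → Equiv.Perm ℕ
  | 0 => 1
  | i + 1 => digitPerm d i * Equiv.swap i (d i)

theorem digitPerm_apply_of_le {d : ℕ → ℕ} (hd : ∀ i, d i ≤ i) :
    ∀ {k j : ℕ}, k ≤ j → digitPerm d k j = j
  | 0, _, _ => rfl
  | k + 1, j, h => by
    have := hd k
    rw [digitPerm, Equiv.Perm.mul_apply, Equiv.swap_apply_of_ne_of_ne (by omega) (by omega)]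
    exact digitPerm_apply_of_le hd (by omega)

theorem digitPerm_lt {d : ℕ → ℕ} (hd : ∀ i, d i ≤ i) {k j : ℕ} (h : j < k) :
    digitPerm d k j < k := by
  by_contra! hle
  have := (digitPerm d k).injective (digitPerm_apply_of_le hd hle)
  omega

theorem digitPerm_congr {d d' : ℕ → ℕ} : ∀ {k : ℕ}, (∀ i < k, d i = d' i) →
    digitPerm d k = digitPerm d' k
  | 0, _ => rfl
  | k + 1, h => by
    rw [digitPerm, digitPerm, h k (Nat.lt_succ_self k),
      digitPerm_congr fun i hi => h i (Nat.lt_succ_of_lt hi)]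

theorem exists_digitPerm : ∀ {k : ℕ} (π : Equiv.Perm ℕ), (∀ j, k ≤ j → π j = j) →
    ∃ d : ℕ → ℕ, (∀ i, d i ≤ i) ∧ digitPerm d k = π
  | 0, π, h => ⟨fun _ => 0, fun _ => Nat.zero_le _, by
      ext j; rw [h j (Nat.zero_le j)]; rfl⟩
  | k + 1, π, h => by
    have hk : π.symm k ≤ k := by
      by_contra! hlt
      have := h _ hlt
      rw [Equiv.apply_symm_apply] at this
      omega
    -- Swapping `k` with its preimage first yields a permutation that also fixes `k`; the preimage
    -- becomes digit number `k`.
    obtain ⟨d, hd, hdp⟩ := exists_digitPerm (k := k) (π * Equiv.swap k (π.symm k)) fun j hj => by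
      rw [Equiv.Perm.mul_apply]
      rcases hj.lt_or_eq with hj | rfl
      · rw [Equiv.swap_apply_of_ne_of_ne (by omega) (by omega), h j hj]
      · rw [Equiv.swap_apply_left, Equiv.apply_symm_apply]
    refine ⟨Function.update d k (π.symm k), fun i => ?_, ?_⟩
    · by_cases hi : i = k
      · subst hi; rwa [Function.update_self]
      · rw [Function.update_of_ne hi]; exact hd i
    · rw [digitPerm, Function.update_self, digitPerm_congr (d' := d) fun i hi =>
        Function.update_of_ne (by omega) _ _, hdp, mul_assoc, Equiv.swap_mul_self, mul_one]

/-- Permutation number `N` of the numbers below `k`. -/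
noncomputable def codedPerm (k N : ℕ) : Equiv.Perm (Fin k) :=
  Equiv.ofBijective
    (fun c => ⟨digitPerm (factorialDigit N) k c, digitPerm_lt (factorialDigit_le N) c.2⟩)
    (Finite.injective_iff_bijective.1 fun _ _ h =>
      Fin.ext ((digitPerm _ k).injective (congrArg Fin.val h)))

theorem codedPerm_val (k N : ℕ) (c : Fin k) :
    (codedPerm k N c : ℕ) = digitPerm (factorialDigit N) k c := rfl

theorem exists_codedPerm {k : ℕ} (e : Equiv.Perm (Fin k)) : ∃ N < k !, codedPerm k N = e := by
  obtain ⟨d, hd, hdp⟩ := exists_digitPerm (k := k) (e.extendDomain Fin.equivSubtype)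
    fun j hj => Equiv.Perm.extendDomain_apply_not_subtype _ _ (by omega)
  obtain ⟨N, hN, h⟩ := exists_factorialDigit d hd k
  refine ⟨N, hN, Equiv.ext fun c => Fin.ext ?_⟩
  rw [codedPerm_val, digitPerm_congr h, hdp]
  exact Equiv.Perm.extendDomain_apply_image e Fin.equivSubtype c

namespace RAM

/-- Write the permutation with the digits in array `11` into array `10`. -/
def permute : Prog :=
  forUp 10 1 (.store 10 10 10) ;;
  forUp 10 1 (.load 11 11 10 ;; .load 12 10 10 ;; .load 13 10 11 ;; .store 10 10 13 ;;
    .store 10 11 12)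

/-- Increment the number with the digits in array `11`; on overflow set register `4` to `0`. -/
def increment : Prog :=
  (.const 10 0 ;; .const 14 1) ;;
  .loop (.eq 14 3)
    (.ite (.lt 10 1)
      (.load 11 11 10 ;;
        .ite (.lt 11 10) (.add 11 11 3 ;; .store 11 10 11 ;; .const 14 0)
          (.store 11 10 2 ;; .add 10 10 3))
      (.const 14 0 ;; .const 4 0))

/-- Exchanging cells `j` and `d j` of the array is multiplication by a transposition on the right,
which is the recursion of `digitPerm`. -/
theorem within_permute {σ : State} {k : ℕ} {d : ℕ → ℕ} (h1 : σ.reg 1 = k) (h3 : σ.reg 3 = 1)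
    (hd : ∀ i, d i ≤ i) (h11 : ∀ i < k, σ.arr 11 i = d i) :
    Within permute σ (10 * k + 4) fun τ => ∀ j < k, τ.arr 10 j = digitPerm d k j := by
  refine (within_forUp (T := 3 * k + 2) (c := 1) (fun j τ => ∀ v < j, τ.arr 10 v = v) h3 h1
    (by simp) (fun j τ _ hj hI hF => Within.of_wp ?_)).seq (T' := 7 * k + 2) fun τ hτ hF => ?_
  · simp [Prog.wp, hj, Function.update_apply]
    intro v hv
    split_ifs with h
    exacts [h.symm, hI v (by omega)]
  refine (within_forUp (T := 7 * k + 2) (c := 5) (n := k)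
    (fun j τ => ∀ v < k, τ.arr 10 v = digitPerm d j v)
    (by rw [hF.reg 3 (by decide), h3]) (by rw [hF.reg 1 (by decide), h1])
    (fun v hv => by simpa [digitPerm] using hτ v hv) fun j υ hjk hj hI hF' => Within.of_wp ?_)
  have e : υ.arr 11 j = d j := by
    rw [hF'.arr 11 (by decide), hF.arr 11 (by decide)]; exact h11 j hjk
  have hdk : d j < k := (hd j).trans_lt hjk
  simp only [Prog.wp]
  intro v hv
  have hnew : ∀ ρ : State, ρ.arr 10 = Function.update (Function.update (υ.arr 10) j
      (υ.arr 10 (d j))) (d j) (υ.arr 10 j) → ρ.arr 10 v = υ.arr 10 (Equiv.swap j (d j) v) :=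
    fun ρ hρ => by
      rw [hρ, Function.update_apply, Function.update_apply, Equiv.swap_apply_def]
      split_ifs with h h' h'
      · rw [← h, h']
      · rfl
      · rfl
      · rfl
  rw [hnew _ (by simp [hj, e]), hI _ (by rw [Equiv.swap_apply_def]; split_ifs <;> omega)]
  rfl

/-- While the carry is at position `j`, `j !` divides `N + 1` and the digits below `j` have been
reset to 0. A carry arriving at position `k` means that `k !` divides `N + 1`, so `N` was the last
number. There are at most `k + 1` rounds: one for each digit and one for the overflow. -/
theorem within_increment {σ : State} {k N : ℕ} (h1 : σ.reg 1 = k) (h2 : σ.reg 2 = 0)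
    (h3 : σ.reg 3 = 1) (hN : N < k !) (h11 : ∀ i < k, σ.arr 11 i = factorialDigit N i) :
    Within increment σ (14 * k + 17) fun τ =>
      (τ.reg 4 = σ.reg 4 ∧ N + 1 < k ! ∧ ∀ i < k, τ.arr 11 i = factorialDigit (N + 1) i) ∨
      (τ.reg 4 = 0 ∧ N + 1 = k !) := by
  refine (Within.of_wp (p := .const 10 0 ;; .const 14 1)
    (Q := fun τ => τ = (σ.setReg 10 0).setReg 14 1) rfl).seq (T' := 14 * k + 15)
    (fun τ hτ _ => ?_) (by simp only [Prog.cost]; omega)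
  subst hτ
  refine (Within.loop (σ := (σ.setReg 10 0).setReg 14 1) (c := 13) (m := k + 1) (fun m τ =>
    (τ.reg 14 = 1 ∧ τ.reg 4 = σ.reg 4 ∧ ∃ j, j + m = k + 1 ∧ τ.reg 10 = j ∧ j ≤ k ∧ j ! ∣ N + 1 ∧
      (∀ v < j, τ.arr 11 v = 0) ∧ ∀ v < k, j ≤ v → τ.arr 11 v = factorialDigit N v) ∨
    (τ.reg 14 = 0 ∧ m = 0 ∧
      ((τ.reg 4 = σ.reg 4 ∧ N + 1 < k ! ∧ ∀ i < k, τ.arr 11 i = factorialDigit (N + 1) i) ∨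
      (τ.reg 4 = 0 ∧ N + 1 = k !)))) ?_ ?_).mono (by omega) ?_
  · intro m τ hI hF hb
    have e1 : τ.reg 1 = k := by rw [hF.reg 1 (by decide)]; simpa using h1
    have e2 : τ.reg 2 = 0 := by rw [hF.reg 2 (by decide)]; simpa using h2
    have e3 : τ.reg 3 = 1 := by rw [hF.reg 3 (by decide)]; simpa using h3
    simp only [Test.Holds, e3] at hb
    rcases hI with ⟨-, h4, j, hjm, hj, hjk, hdvd, hlow, hhigh⟩ | ⟨h, -⟩
    swap
    · omega
    refine (Within.of_wp ?_).mono (show Prog.cost _ ≤ 13 by decide) fun _ h _ => h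
    simp only [Prog.wp, Test.Holds]
    refine ⟨fun hlt => ⟨fun hd => ?_, fun hd => ?_⟩, fun hlt => ?_⟩
    · rw [hj, e1] at hlt
      have hdig := hhigh j hlt le_rfl
      have hd' : factorialDigit N j < j := by simpa [hj, hdig] using hd
      refine ⟨0, by omega, .inr ⟨by simp, rfl, .inl ⟨by simpa using h4, ?_, fun v hv => ?_⟩⟩⟩
      -- If `N + 1` were `k !`, it would be divisible by `(j + 1)!`, and digit `j` would be maximal.
      · refine lt_of_le_of_ne hN fun heq => hd'.ne ((factorial_succ_dvd hdvd).1 ?_)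
        rw [heq]
        exact Nat.factorial_dvd_factorial hlt
      · have hnew : ∀ ρ : State, ρ.arr 11 = Function.update (τ.arr 11) j (factorialDigit N j + 1) →
            ρ.arr 11 v = factorialDigit (N + 1) v := fun ρ hρ => by
          rw [hρ]
          rcases lt_trichotomy v j with h | rfl | h
          · rw [Function.update_of_ne h.ne, hlow v h, factorialDigit_succ_of_lt hdvd h]
          · rw [Function.update_self, factorialDigit_succ_self hdvd hd']
          · rw [Function.update_of_ne h.ne', hhigh v hv h.le, factorialDigit_succ_of_gt hdvd hd' h]
        exact hnew _ (by simp [hj, hdig, e3])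
    · rw [hj, e1] at hlt
      have hdig := hhigh j hlt le_rfl
      have hd' : factorialDigit N j = j := by
        have : ¬ factorialDigit N j < j := by simpa [hj, hdig] using hd
        have := factorialDigit_le N j
        omega
      have hnew : ∀ ρ : State, ρ.arr 11 = Function.update (τ.arr 11) j 0 →
          (∀ v < j + 1, ρ.arr 11 v = 0) ∧
            ∀ v < k, j + 1 ≤ v → ρ.arr 11 v = factorialDigit N v := fun ρ hρ => by
        rw [hρ]
        refine ⟨fun v hv => ?_, fun v hv hjv => ?_⟩
        · rcases Nat.lt_succ_iff_lt_or_eq.1 hv with h | rfl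
          · rw [Function.update_of_ne h.ne, hlow v h]
          · rw [Function.update_self]
        · rw [Function.update_of_ne (by omega), hhigh v hv (by omega)]
      exact ⟨m - 1, by omega, .inl ⟨by simpa using hb, by simpa using h4, j + 1, by omega,
        by simp [hj, e3], hlt, (factorial_succ_dvd hdvd).2 hd',
        hnew _ (by simp [hj, e2])⟩⟩
    · rw [hj, e1] at hlt
      obtain rfl : j = k := by omega
      exact ⟨0, by omega, .inr ⟨by simp, rfl, .inr ⟨by simp,
        le_antisymm hN (Nat.le_of_dvd (Nat.succ_pos N) hdvd)⟩⟩⟩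
  · exact .inl ⟨by simp, by simp, 0, by omega, by simp, Nat.zero_le k, by simp, by simp,
      fun v hv _ => by simpa using h11 v hv⟩
  · rintro τ ⟨hb, m', -, hI⟩ hF
    have e3 : τ.reg 3 = 1 := by rw [hF.reg 3 (by decide)]; simpa using h3
    rcases hI with ⟨h, -⟩ | ⟨-, -, h⟩
    · exact absurd (by rw [Test.Holds, h, e3]) hb
    · exact h

end RAM

/-! ### The encoding of instances, and solvability in a given order. -/

theorem startIndex_eq {n : ℕ} (L : Fin n → List (Fin n)) (v : ℕ) :
    startIndex L v = ((List.ofFn L).take v).flatten.length := by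
  rw [List.length_flatten, List.map_take, List.map_ofFn, List.sum_take_ofFn]
  rfl

theorem isAdjacencyArray_concatLists {n : ℕ} (L : Fin n → List (Fin n)) :
    IsAdjacencyArray L (startIndex L) fun i => (concatLists L).getD i 0 := by
  have hv : ∀ v : Fin n, (v : ℕ) < (List.ofFn L).length := fun v => by simp
  constructor
  · intro v
    rw [startIndex_eq, startIndex_eq, List.take_add_one, List.getElem?_eq_getElem (hv v)]
    simp
  · intro v i hi
    have hsplit : (List.ofFn L).flatten = ((List.ofFn L).take v).flatten ++
        (L v ++ ((List.ofFn L).drop (v + 1)).flatten) := by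
      conv_lhs => rw [← List.take_append_drop v (List.ofFn L), List.drop_eq_getElem_cons (hv v)]
      simp
    rw [concatLists, startIndex_eq, List.getD_eq_getElem?_getD, List.getElem?_map, hsplit,
      List.getElem?_append_right (Nat.le_add_right _ _), Nat.add_sub_cancel_left,
      List.getElem?_append_left hi, List.getElem?_eq_getElem hi]
    rfl

namespace UPDPInstance

variable (J : UPDPInstance)

theorem isOutList : J.drawing.IsOutList J.outList := ⟨J.mem_outList, J.outList_sorted⟩

/-- The pairs can be linked by paths that are ordered from left to right as in permutation number
`N`. -/
def SolvableInOrder (N : ℕ) : Prop :=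
  J.drawing.OrderedSolvable (J.source ∘ codedPerm J.k N) (J.target ∘ codedPerm J.k N)
    (range J.source ∪ range J.target) 0

theorem Solvable.exists_order {J : UPDPInstance} (h : J.Solvable) :
    ∃ N < J.k !, J.SolvableInOrder N := by
  obtain ⟨p, hp, hd⟩ := h
  obtain ⟨e, he⟩ := UpwardDrawing.exists_orderedSolvable (D := J.drawing) hp hd
  obtain ⟨N, hN, rfl⟩ := exists_codedPerm e
  exact ⟨N, hN, he⟩

theorem solvable_of_partlySolved {e : Equiv.Perm (Fin J.k)} {B : Set (Fin J.n)}
    (h : UpwardDrawing.PartlySolved J.graph (J.source ∘ e) (J.target ∘ e) B J.k) :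
    J.Solvable := by
  obtain ⟨p, hp, hd⟩ := h
  refine ⟨p ∘ e.symm, fun i => ?_, fun i j hij => hd _ _ (Fin.is_lt _) (Fin.is_lt _)
    (e.symm.injective.ne hij)⟩
  simpa using (hp (e.symm i) (Fin.is_lt _)).1

end UPDPInstance

/-! ### The complete program: trying all orders. -/

namespace RAM

/-- Try the current permutation; if it fails, go to the next one. Register `6` is set to `1` on
success and register `4` is set to `0` when nothing is left to do. -/
def tryOrder : Prog :=
  permute ;; initBlocked ;; greedy ;; .ite (.eq 5 3) (.const 6 1 ;; .const 4 0) increment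

/-- The program that solves the disjoint paths problem on upward planar digraphs. -/
def solve : Prog :=
  .const 3 1 ;;
  .ite (.eq 1 2) (.const 0 1) (.const 4 1 ;; .loop (.eq 4 3) tryOrder ;; .add 0 6 2)

/-- The registers `0` to `3` and the arrays `0` to `3` are as they should be. -/
structure HasInput (J : UPDPInstance) (σ : State) : Prop where
  n : σ.reg 0 = J.n
  k : σ.reg 1 = J.k
  zero : σ.reg 2 = 0
  one : σ.reg 3 = 1
  source : ∀ c : Fin J.k, σ.arr 0 c = J.source c
  target : ∀ c : Fin J.k, σ.arr 1 c = J.target c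
  adj : IsAdjacencyArray J.outList (σ.arr 2) (σ.arr 3)

theorem HasInput.of_frame {J : UPDPInstance} {p : Prog} {σ τ : State} (h : HasInput J σ)
    (hF : Frame p σ τ) (hr : ∀ r < 4, p.setsReg r = false := by decide)
    (hA : ∀ A < 4, p.setsArr A = false := by decide) : HasInput J τ where
  n := by rw [hF.reg 0 (hr 0 (by decide)), h.n]
  k := by rw [hF.reg 1 (hr 1 (by decide)), h.k]
  zero := by rw [hF.reg 2 (hr 2 (by decide)), h.zero]
  one := by rw [hF.reg 3 (hr 3 (by decide)), h.one]
  source := by rw [hF.arr 0 (hA 0 (by decide))]; exact h.source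
  target := by rw [hF.arr 1 (hA 1 (by decide))]; exact h.target
  adj := by rw [hF.arr 2 (hA 2 (by decide)), hF.arr 3 (hA 3 (by decide))]; exact h.adj

/-- Soundness of the greedy procedure makes a positive outcome correct at once. A negative one
excludes only this order, which is why the failure is recorded for `N`. -/
theorem within_tryOrder {J : UPDPInstance} {σ : State} (h : HasInput J σ) {N : ℕ}
    (hN : N < J.k !) (h4 : σ.reg 4 = 1) (h6 : σ.reg 6 = 0)
    (h11 : ∀ i < J.k, σ.arr 11 i = factorialDigit N i) :
    Within tryOrder σ (406 * (J.n * J.k) + 30 * J.k + 3 * J.n + 29 + 6 * J.k) fun τ =>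
      (τ.reg 4 = 1 ∧ τ.reg 6 = 0 ∧ N + 1 < J.k ! ∧
        (∀ i < J.k, τ.arr 11 i = factorialDigit (N + 1) i) ∧ ¬ J.SolvableInOrder N) ∨
      (τ.reg 4 = 0 ∧ τ.reg 6 = 1 ∧ J.Solvable) ∨
      (τ.reg 4 = 0 ∧ τ.reg 6 = 0 ∧ N + 1 = J.k ! ∧ ¬ J.SolvableInOrder N) := by
  have hmul : (400 * J.n + 6) * J.k = 400 * (J.n * J.k) + 6 * J.k := by ring
  refine (within_permute h.k h.one (factorialDigit_le N) h11).seq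
    (T' := 406 * (J.n * J.k) + 26 * J.k + 3 * J.n + 25) fun τ₁ h10 hF₁ => ?_
  have i₁ := h.of_frame hF₁
  refine (within_initBlocked i₁.n i₁.k i₁.zero i₁.one i₁.source i₁.target).seq
    (T' := 406 * (J.n * J.k) + 20 * J.k + 21) fun τ₂ hB hF₂ => ?_
  have i₂ := i₁.of_frame hF₂
  have h10' : ∀ c : Fin J.k, τ₂.arr 10 c = codedPerm J.k N c := fun c => by
    rw [hF₂.arr 10 (by decide), h10 c c.2, codedPerm_val]
  refine (within_greedy (s := J.source ∘ codedPerm J.k N) (t := J.target ∘ codedPerm J.k N)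
    J.isOutList i₂.adj i₂.n i₂.k i₂.zero i₂.one
    (fun c => by rw [h10']; exact i₂.source _) (fun c => by rw [h10']; exact i₂.target _)
    (fun c => by rw [hB]; exact ⟨.inl ⟨_, rfl⟩, .inr ⟨_, rfl⟩⟩)).seq
    (T' := 14 * J.k + 18) fun τ₃ ⟨hsound, hcomplete⟩ hF₃ => ?_
  have i₃ := i₂.of_frame hF₃
  rw [hB] at hcomplete
  have e6 : τ₃.reg 6 = 0 := by
    rw [hF₃.reg 6 (by decide), hF₂.reg 6 (by decide), hF₁.reg 6 (by decide), h6]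
  have e4 : τ₃.reg 4 = 1 := by
    rw [hF₃.reg 4 (by decide), hF₂.reg 4 (by decide), hF₁.reg 4 (by decide), h4]
  have e11 : τ₃.arr 11 = σ.arr 11 := by
    rw [hF₃.arr 11 (by decide), hF₂.arr 11 (by decide), hF₁.arr 11 (by decide)]
  refine Within.ite (T := 14 * J.k + 17) (fun hb => ?_) (fun hb => ?_)
  · rw [Test.Holds, i₃.one] at hb
    obtain ⟨B, hs⟩ := hsound (by omega)
    exact (Within.of_wp (by simp [Prog.wp, J.solvable_of_partlySolved hs])).mono
      (by simp only [Prog.cost]; omega) fun _ h _ => .inr (.inl h)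
  · have hno : ¬ J.SolvableInOrder N := fun hso => hb (by
      rw [Test.Holds, i₃.one]; exact hcomplete hso)
    refine (within_increment i₃.k i₃.zero i₃.one hN (by rw [e11]; exact h11)).mono le_rfl
      fun τ hτ hF₄ => ?_
    have q6 : τ.reg 6 = 0 := by rw [hF₄.reg 6 (by decide), e6]
    rcases hτ with ⟨a, b, c⟩ | ⟨a, b⟩
    · exact .inl ⟨a.trans e4, q6, b, c, hno⟩
    · exact .inr (.inr ⟨a, q6, b, hno⟩)

theorem within_solve (J : UPDPInstance) :
    Within solve J.initialState (600 * max 1 (J.k ! * J.k * J.n)) fun τ =>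
      (J.Solvable → τ.reg 0 = 1) ∧ (¬ J.Solvable → τ.reg 0 = 0) := by
  have hmax : 1 ≤ max 1 (J.k ! * J.k * J.n) := le_max_left _ _
  refine (Within.of_wp (p := .const 3 1) (Q := fun τ => τ = J.initialState.setReg 3 1) rfl).seq
    (T' := 600 * max 1 (J.k ! * J.k * J.n) - 1) (fun σ hσ _ => ?_)
    (by simp only [Prog.cost]; omega)
  have hin : HasInput J σ := by
    subst hσ
    refine ⟨by simp [UPDPInstance.initialState], by simp [UPDPInstance.initialState],
      by simp [UPDPInstance.initialState], by simp, fun c => by simp [UPDPInstance.initialState],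
      fun c => by simp [UPDPInstance.initialState], ?_⟩
    have hA := isAdjacencyArray_concatLists J.outList
    refine ⟨fun v => ?_, fun v i hi => ?_⟩
    · have h1 : (v : ℕ) + 1 ≤ J.n := v.2
      have h2 : (v : ℕ) ≤ J.n := v.2.le
      simpa [UPDPInstance.initialState, h1, h2] using hA.succ v
    · have h2 : (v : ℕ) ≤ J.n := v.2.le
      simpa [UPDPInstance.initialState, h2] using hA.get v i hi
  have h6 : σ.reg 6 = 0 := by subst hσ; simp [UPDPInstance.initialState]
  have h11 : ∀ i, σ.arr 11 i = 0 := fun i => by subst hσ; simp [UPDPInstance.initialState]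
  clear hσ
  refine Within.ite (T := 600 * max 1 (J.k ! * J.k * J.n) - 2) (fun hb => ?_) (fun hb => ?_)
  · rw [Test.Holds, hin.k, hin.zero] at hb
    -- Without pairs there is nothing to link, and `n` may be 0; this is the case for which the
    -- bound has the maximum with 1.
    have hsol : J.Solvable :=
      ⟨fun _ => [], fun i => absurd i.2 (by omega), fun i => absurd i.2 (by omega)⟩
    exact (Within.of_wp (p := .const 0 1) (by simp [Prog.wp, hsol])).mono
      (by simp only [Prog.cost]; omega) fun _ h _ => h
  rw [Test.Holds, hin.k, hin.zero] at hb
  have hk : 0 < J.k := Nat.pos_of_ne_zero hb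
  have hn : 0 < J.n := (J.source ⟨0, hk⟩).pos
  have hnk : 0 < J.n * J.k := Nat.mul_pos hn hk
  have hkle : J.k ≤ J.n * J.k := Nat.le_mul_of_pos_left _ hn
  have hnle : J.n ≤ J.n * J.k := Nat.le_mul_of_pos_right _ hk
  have hfac : 0 < J.k ! := Nat.factorial_pos _
  have hmul : J.k ! * J.k * J.n = J.k ! * (J.n * J.k) := by ring
  have hle : J.n * J.k ≤ J.k ! * (J.n * J.k) := Nat.le_mul_of_pos_left _ hfac
  have hmax' : max 1 (J.k ! * J.k * J.n) = J.k ! * (J.n * J.k) := by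
    rw [hmul]; exact max_eq_right (by omega)
  rw [hmax']
  refine (Within.of_wp (p := .const 4 1) (Q := fun τ => τ = σ.setReg 4 1) rfl).seq
    (T' := 600 * (J.k ! * (J.n * J.k)) - 3) (fun τ₁ hτ₁ hF₁ => ?_)
    (by simp only [Prog.cost]; omega)
  have i₁ := hin.of_frame hF₁
  refine (Within.loop (c := 500 * (J.n * J.k) - 1) (m := J.k !) (fun m τ =>
    (τ.reg 4 = 1 ∧ τ.reg 6 = 0 ∧ ∃ N < J.k !, N + m = J.k ! ∧
      (∀ i < J.k, τ.arr 11 i = factorialDigit N i) ∧ ∀ N' < N, ¬ J.SolvableInOrder N') ∨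
    (m = 0 ∧ τ.reg 4 = 0 ∧ ((τ.reg 6 = 1 ∧ J.Solvable) ∨ (τ.reg 6 = 0 ∧ ¬ J.Solvable))))
    (fun m τ hI hF hb => ?_) ?_).seq (T' := 1) (fun τ₂ hτ₂ hF₂ => ?_) ?_
  · have i₂ := i₁.of_frame hF
    rw [Test.Holds, i₂.one] at hb
    rcases hI with ⟨h4, h6, N, hN, hNm, hdig, hfail⟩ | ⟨-, h4, -⟩
    swap
    · omega
    -- With `n` and `k` positive, every term is at most a multiple of `n * k`; the coefficients add
    -- up to 474, which is below 500.
    refine (within_tryOrder i₂ hN h4 h6 hdig).mono (by omega) fun υ hυ _ => ?_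
    have hfail' : ¬ J.SolvableInOrder N → ∀ N' < N + 1, ¬ J.SolvableInOrder N' :=
      fun hno N' hN' => by
        rcases Nat.lt_succ_iff_lt_or_eq.1 hN' with h | rfl
        exacts [hfail N' h, hno]
    rcases hυ with ⟨a, b, c, d, e⟩ | ⟨a, b, c⟩ | ⟨a, b, c, e⟩
    · exact ⟨m - 1, by omega, .inl ⟨a, b, N + 1, c, by omega, d, hfail' e⟩⟩
    · exact ⟨0, by omega, .inr ⟨rfl, a, .inl ⟨b, c⟩⟩⟩
    -- All `k !` orders have failed, while the paths of any solution could be numbered from left to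
    -- right in one of them.
    · refine ⟨0, by omega, .inr ⟨rfl, a, .inr ⟨b, fun hsol => ?_⟩⟩⟩
      obtain ⟨N', hN', h⟩ := hsol.exists_order
      exact hfail' e N' (by omega) h
  · subst hτ₁
    exact .inl ⟨by simp, by simpa using h6, 0, hfac, zero_add _,
      fun i _ => by simpa [factorialDigit_zero] using h11 i,
      fun N' hN' => absurd hN' (Nat.not_lt_zero _)⟩
  · have i₂ := i₁.of_frame hF₂
    obtain ⟨hb, m', -, hI⟩ := hτ₂
    rw [Test.Holds, i₂.one] at hb
    rcases hI with ⟨h4, -⟩ | ⟨-, -, h⟩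
    · exact absurd h4 hb
    · refine Within.of_wp (p := .add 0 6 2) ?_
      rcases h with ⟨h, hs⟩ | ⟨h, hs⟩ <;> simp [Prog.wp, h, hs, i₂.zero]
  · have e1 : 500 * (J.n * J.k) - 1 + 1 = 500 * (J.n * J.k) := by omega
    have e2 : 500 * (J.n * J.k) * J.k ! = 500 * (J.k ! * (J.n * J.k)) := by ring
    rw [e1, e2]
    omega

end RAM

/-- A single program decides every instance, with the answer (`1` for yes, `0` for no) in register
`0`, within `C * (k! * k * n)` steps (within `C` steps if `k = 0`). -/
theorem theorem3 :
    ∃ (P : RAM.Prog) (C : ℕ), ∀ J : UPDPInstance,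
      ∃ (t : ℕ) (τ : RAM.State), RAM.Runs P J.initialState t τ ∧
        t ≤ C * max 1 (J.k ! * J.k * J.n) ∧
        (J.Solvable → τ.reg 0 = 1) ∧ (¬ J.Solvable → τ.reg 0 = 0) :=
  ⟨RAM.solve, 600, RAM.within_solve⟩
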